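/- Let $n,m\ge 1$ and let $\ell,\ell_1,\dots,\ell_n$ be positive integers. Put $\gamma=(\gamma_1,\dots,\gamma_n)=(\ell/\ell_1,\dots,\ell/\ell_n)$ and $\|\gamma\|=\gamma_1+\cdots+\gamma_n$. Let $$\mathcal L u=\sum_{\alpha\cdot\gamma=\ell}A_\alpha\,\partial^\alpha u$$ be a differential operator acting on functions $u:\mathbb R^n\to\mathbb C^m$, with constant coefficients $A_\alpha\in\mathbb C^{m\times m}$, of order $\ell=\max\{|\alpha| : A_\alpha\ne 0\}$, where $\alpha$ runs over multi-indices, $\alpha\cdot\gamma=\sum_k\alpha_k\gamma_k$ and $|\alpha|=\sum_k\alpha_k$. Assume that $\mathcal L$ is semielliptic, that is, its symbol $L(x)=\sum_{\alpha\cdot\gamma=\ell}A_\alpha (ix)^\alpha$ is an invertible matrix for every nonzero $x\in\mathbb R^n$. Let $\sigma(z)=\sum_{k=1}^n z_k^{2\ell_k}$ and define the $m\times m$ matrix functions $$J(x,t)=\int_{\mathbb R^n}e^{ix\cdot z}\,\sigma(z)\,e^{-t\sigma(z)}\,L(z)^{-1}\,dz\quad(x\in\mathbb R^n,\ t>0),\qquad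 F(x)=(2\pi)^{-n}\int_0^\infty J(x,t)\,dt\quad(x\ne0).$$ Theorem. Assume $\|\gamma\|>\ell$. Then $F$ is well defined: the integral for $J(x,t)$ converges absolutely for all $x\in\mathbb R^n$, $t>0$, and the integral for $F(x)$ converges absolutely for all $x\neq 0$. Moreover, for every $f\in C_0^\infty(\mathbb R^n,\mathbb C^m)$, the convolution integral $$\mathcal Sf(x)=(F*f)(x)=\int_{\mathbb R^n}F(x-y)f(y)\,dy$$ converges absolutely for every $x\in\mathbb R^n$, $\mathcal Sf\in C^\infty(\mathbb R^n,\mathbb C^m)$, and $\mathcal L(\mathcal Sf)=f$ on $\mathbb R^n$. (In this sense $F$ is a fundamental solution for $\mathcal L$.) -/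

import Mathlib

open scoped ContDiff

noncomputable section

namespace Semielliptic

/-- The vector `γ = (ℓ/ℓ₁, …, ℓ/ℓₙ)` of rational numbers. -/
def gam {n : ℕ} (l : ℕ) (lv : Fin n → ℕ) (k : Fin n) : ℚ :=
  (l : ℚ) / (lv k : ℚ)

/-- The norm `‖γ‖ = γ₁ + ⋯ + γₙ`. -/
def gamNorm {n : ℕ} (l : ℕ) (lv : Fin n → ℕ) : ℚ :=
  ∑ k, gam l lv k

/-- The symbol `L(x) = ∑_α (ix)^α A_α` of the operator with coefficients `A`.
The family `A` is finitely supported on the multi-indices. -/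
def symbol {n m : ℕ} (A : (Fin n → ℕ) →₀ Matrix (Fin m) (Fin m) ℂ)
    (x : EuclideanSpace ℝ (Fin n)) : Matrix (Fin m) (Fin m) ℂ :=
  A.sum fun α M => (∏ k, (Complex.I * (x k : ℂ)) ^ α k) • M

/-- The first order partial derivative `∂u/∂x_k`. -/
def pderiv {n m : ℕ} (k : Fin n) (u : EuclideanSpace ℝ (Fin n) → Fin m → ℂ) :
    EuclideanSpace ℝ (Fin n) → Fin m → ℂ :=
  fun x => lineDeriv ℝ u x (EuclideanSpace.single k (1 : ℝ))

/-- The derivative `∂^α u = ∂₁^{α₁} ⋯ ∂ₙ^{αₙ} u` for a multi-index `α`. -/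
def multiDeriv {n m : ℕ} (α : Fin n → ℕ) (u : EuclideanSpace ℝ (Fin n) → Fin m → ℂ) :
    EuclideanSpace ℝ (Fin n) → Fin m → ℂ :=
  (List.finRange n).foldr (fun k v => (pderiv k)^[α k] v) u

/-- The differential operator `ℒu = ∑_α A_α ∂^α u`. -/
def diffOp {n m : ℕ} (A : (Fin n → ℕ) →₀ Matrix (Fin m) (Fin m) ℂ)
    (u : EuclideanSpace ℝ (Fin n) → Fin m → ℂ) : EuclideanSpace ℝ (Fin n) → Fin m → ℂ :=
  fun x => A.sum fun α M => M.mulVec (multiDeriv α u x)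

/-- `ℒ = ∑_{α·γ = ℓ} A_α ∂^α` is a semielliptic operator of order `ℓ`, where
`γ = (ℓ/ℓ₁, …, ℓ/ℓₙ)`. -/
structure IsSemielliptic {n m : ℕ} (l : ℕ) (lv : Fin n → ℕ)
    (A : (Fin n → ℕ) →₀ Matrix (Fin m) (Fin m) ℂ) : Prop where
  /-- the order is positive -/
  order_pos : 0 < l
  /-- each `ℓ_k` is positive -/
  lv_pos : ∀ k, 0 < lv k
  /-- only multi-indices with `α·γ = ℓ` occur -/
  weight : ∀ α, A α ≠ 0 → ∑ k, (α k : ℚ) * gam l lv k = (l : ℚ)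
  /-- `ℓ = max {|α| : A_α ≠ 0}` -/
  order_eq : IsGreatest {d : ℕ | ∃ α, A α ≠ 0 ∧ d = ∑ k, α k} l
  /-- the symbol is invertible away from the origin -/
  symbol_isUnit : ∀ x, x ≠ 0 → IsUnit (symbol A x)

/-- `σ(x) = ∑_k x_k^{2ℓ_k}`. -/
def sigma {n : ℕ} (lv : Fin n → ℕ) (x : EuclideanSpace ℝ (Fin n)) : ℝ :=
  ∑ k, x k ^ (2 * lv k)

/-- The matrix `e^{ix·z} σ(z) e^{-tσ(z)} L(z)⁻¹`. -/
def kernelIntegrand {n m : ℕ} (lv : Fin n → ℕ) (A : (Fin n → ℕ) →₀ Matrix (Fin m) (Fin m) ℂ)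
    (x : EuclideanSpace ℝ (Fin n)) (t : ℝ) (z : EuclideanSpace ℝ (Fin n)) :
    Matrix (Fin m) (Fin m) ℂ :=
  (Complex.exp (Complex.I * ((∑ k, x k * z k : ℝ) : ℂ)) * (sigma lv z : ℂ) *
    Complex.exp (-((t * sigma lv z : ℝ) : ℂ))) • (symbol A z)⁻¹

/-- `J(x,t) = ∫ e^{ix·z} σ(z) e^{-tσ(z)} L(z)⁻¹ dz`, the integral being taken entrywise. -/
def kernelJ {n m : ℕ} (lv : Fin n → ℕ) (A : (Fin n → ℕ) →₀ Matrix (Fin m) (Fin m) ℂ)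
    (x : EuclideanSpace ℝ (Fin n)) (t : ℝ) : Matrix (Fin m) (Fin m) ℂ :=
  Matrix.of fun i j => ∫ z, kernelIntegrand lv A x t z i j

/-- `F(x) = (2π)^{-n} ∫₀^∞ J(x,t) dt` for `x ≠ 0`, the integral being taken entrywise.
(The value that the formula happens to give at `x = 0` has no meaning.) -/
def fundSol {n m : ℕ} (lv : Fin n → ℕ) (A : (Fin n → ℕ) →₀ Matrix (Fin m) (Fin m) ℂ)
    (x : EuclideanSpace ℝ (Fin n)) : Matrix (Fin m) (Fin m) ℂ :=
  Matrix.of fun i j =>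
    (((2 * Real.pi) ^ n : ℝ) : ℂ)⁻¹ * ∫ t in Set.Ioi (0 : ℝ), kernelJ lv A x t i j

/-- `𝒮f(x) = (F * f)(x) = ∫ F(x - y) f(y) dy`. -/
def opS {n m : ℕ} (lv : Fin n → ℕ) (A : (Fin n → ℕ) →₀ Matrix (Fin m) (Fin m) ℂ)
    (f : EuclideanSpace ℝ (Fin n) → Fin m → ℂ) : EuclideanSpace ℝ (Fin n) → Fin m → ℂ :=
  fun x => ∫ y, (fundSol lv A (x - y)).mulVec (f y)

end Semielliptic

end

/-!
The anisotropic dilations `z ↦ (s^{1/(2ℓ₁)} z₁, …, s^{1/(2ℓₙ)} zₙ)` make `σ` homogeneous of degree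
`1` and `L⁻¹` homogeneous of degree `-1/2`; their Jacobian is `s^Q` with `Q = ∑ 1/(2ℓₖ)`, and
`‖γ‖ > ℓ` says exactly that `Q > 1/2`. Hence `J(x, t) = t^{-(1/2 + Q)} J(t⁻¹ · x, 1)`, which is
integrable at `t = ∞`. Near `t = 0` one needs decay of `J(·, 1)`. Each coordinate function `xₖ`
turns into a derivative of the integrand, which lowers the degree of homogeneity by `1/(2ℓₖ)`, so
this may be repeated only until the degree reaches `-Q`; writing `J` as a superposition of kernels
with a higher power of `σ` then upgrades the resulting bound to the decay that integrability in `x`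
requires.

Since `∫₀^∞ σ e^{-tσ} dt = 1`, exchanging integrals gives
`(F * f)(x) = (2π)⁻ⁿ ∫ e^{i⟨x, z⟩} L(z)⁻¹ f̂(z) dz`, and `L⁻¹` is locally integrable because
`Q > 1/2`. All moments of `L⁻¹ f̂` are finite, so `F * f` is smooth, and `ℒ` acts under the integral
as multiplication by `L(z)`, leaving the Fourier inversion formula for `f`.
-/

noncomputable section

namespace Semielliptic

open MeasureTheory Set Filter Topology
open scoped SchwartzMap FourierTransform RealInnerProductSpace

section Fourier

variable {E : Type*} [NormedAddCommGroup E] [InnerProductSpace ℝ E]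
variable {V : Type*} [NormedAddCommGroup V] [NormedSpace ℂ V]

/-- The plane wave `z ↦ e^{i⟨x, z⟩}` of frequency `x`. -/
def planeWave (x z : E) : ℂ := Complex.exp (⟪x, z⟫ * Complex.I)

@[simp]
lemma norm_planeWave (x z : E) : ‖planeWave x z‖ = 1 :=
  Complex.norm_exp_ofReal_mul_I _

lemma continuous_planeWave : Continuous fun p : E × E => planeWave p.1 p.2 := by
  unfold planeWave
  fun_prop

lemma continuous_planeWave_right (x : E) : Continuous (planeWave x) :=
  continuous_planeWave.comp (Continuous.prodMk_right x)

lemma planeWave_comm (x z : E) : planeWave x z = planeWave z x := by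
  rw [planeWave, planeWave, real_inner_comm]

lemma planeWave_sub_left (x y z : E) :
    planeWave (x - y) z = planeWave x z * planeWave (-z) y := by
  rw [planeWave, planeWave, planeWave, ← Complex.exp_add, inner_sub_left, inner_neg_left,
    real_inner_comm z y]
  push_cast
  ring_nf

lemma hasDerivAt_planeWave (x v z : E) (t : ℝ) :
    HasDerivAt (fun t : ℝ => planeWave (x + t • v) z)
      (Complex.I * ⟪z, v⟫ * planeWave (x + t • v) z) t := by
  have h : HasDerivAt (fun t : ℝ => ((⟪x + t • v, z⟫ : ℝ) : ℂ) * Complex.I)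
      (⟪z, v⟫ * Complex.I) t := by
    simp only [inner_add_left, real_inner_smul_left, real_inner_comm z v]
    exact (((hasDerivAt_mul_const ⟪z, v⟫).const_add ⟪x, z⟫).ofReal_comp).mul_const _
  rw [mul_comm, mul_comm Complex.I]
  exact h.cexp

lemma hasLineDerivAt_planeWave (x v z : E) :
    HasLineDerivAt ℝ (planeWave x) (Complex.I * ⟪x, v⟫ * planeWave x z) z v := by
  simpa only [HasLineDerivAt, planeWave_comm x, zero_smul, add_zero] using
    hasDerivAt_planeWave z v x 0

variable [MeasurableSpace E] [BorelSpace E] [FiniteDimensional ℝ E]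

lemma integrable_planeWave_smul {G : E → V} (hG : Integrable G) (x : E) :
    Integrable fun z => planeWave x z • G z :=
  hG.bdd_smul 1 (continuous_planeWave_right x).aestronglyMeasurable
    (ae_of_all _ fun z => (norm_planeWave x z).le)

/-- The inverse Fourier transform `x ↦ ∫ e^{i⟨x, z⟩} G(z) dz`, without the factor `(2π)⁻ⁿ`. -/
def invFourierInt (G : E → V) (x : E) : V := ∫ z, planeWave x z • G z

lemma invFourierInt_sub {G H : E → V} (hG : Integrable G) (hH : Integrable H) (x : E) :
    invFourierInt (G - H) x = invFourierInt G x - invFourierInt H x := by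
  simp only [invFourierInt, Pi.sub_apply, smul_sub]
  exact integral_sub (integrable_planeWave_smul hG x) (integrable_planeWave_smul hH x)

lemma norm_invFourierInt_le (G : E → V) (x : E) : ‖invFourierInt G x‖ ≤ ∫ z, ‖G z‖ := by
  refine (norm_integral_le_integral_norm _).trans_eq ?_
  simp only [norm_smul, norm_planeWave, one_mul]

lemma invFourierInt_eq_fourier (G : E → V) (x : E) :
    invFourierInt G x = 𝓕 G ((-(2 * Real.pi)⁻¹ : ℝ) • x) := by
  rw [Real.fourier_eq', invFourierInt]
  refine integral_congr_ae (ae_of_all _ fun z => ?_)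
  have : Real.pi ≠ 0 := Real.pi_ne_zero
  simp only [planeWave, inner_smul_right, real_inner_comm z x]
  congr 4
  field_simp

lemma invFourierInt_apply {ι : Type*} [Fintype ι] {G : E → ι → ℂ} (hG : Integrable G) (x : E)
    (i : ι) : invFourierInt G x i = invFourierInt (fun z => G z i) x :=
  eval_integral (fun j => (integrable_planeWave_smul hG x).eval j) i

lemma invFourierInt_lineDeriv_eq {u u' : E → ℂ} {v : E} (hu : Integrable u)
    (hu' : Integrable u') (h : ∀ z, HasLineDerivAt ℝ u (u' z) z v) (x : E) :
    invFourierInt u' x = -(Complex.I * ⟪x, v⟫) * invFourierInt u x := by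
  have hw : Integrable fun z => Complex.I * ⟪x, v⟫ * planeWave x z * u z := by
    simpa only [mul_assoc, smul_eq_mul] using
      (integrable_planeWave_smul hu x).const_mul (Complex.I * ⟪x, v⟫)
  have := integral_bilinear_hasLineDerivAt_right_eq_neg_left_of_integrable
    (B := ContinuousLinearMap.mul ℝ ℂ) (f := planeWave x) (g := u) hw
    (integrable_planeWave_smul hu' x) (integrable_planeWave_smul hu x)
    (fun z _ => hasLineDerivAt_planeWave x v z) (fun z _ => h z)
  simp only [ContinuousLinearMap.mul_apply', mul_assoc] at this
  simp only [invFourierInt, smul_eq_mul, this, integral_const_mul, neg_mul, mul_assoc]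

lemma integral_invFourierInt_sub_mul {h φ : E → ℂ} (hh : Integrable h) (hφ : Integrable φ)
    (x : E) : ∫ y, invFourierInt h (x - y) * φ y =
      invFourierInt (fun z => h z * invFourierInt φ (-z)) x := by
  have hint : Integrable (fun p : E × E => planeWave (x - p.1) p.2 * (φ p.1 * h p.2)) :=
    (hφ.mul_prod hh).bdd_mul (c := 1) (continuous_planeWave.comp
      ((continuous_const.sub continuous_fst).prodMk continuous_snd)).aestronglyMeasurable
      (ae_of_all _ fun p => (norm_planeWave _ _).le)
  calc ∫ y, invFourierInt h (x - y) * φ y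
      = ∫ y, ∫ z, planeWave (x - y) z * (φ y * h z) := by
        simp only [invFourierInt, smul_eq_mul, ← integral_mul_const]
        refine integral_congr_ae (ae_of_all _ fun y => integral_congr_ae (ae_of_all _ fun z => ?_))
        ring
    _ = ∫ z, ∫ y, planeWave (x - y) z * (φ y * h z) := integral_integral_swap hint
    _ = invFourierInt (fun z => h z * invFourierInt φ (-z)) x := by
        simp only [invFourierInt, smul_eq_mul, ← integral_const_mul, planeWave_sub_left]
        refine integral_congr_ae (ae_of_all _ fun z => integral_congr_ae (ae_of_all _ fun y => ?_))
        ring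

/-- All moments of `G` are finite, so that its inverse Fourier transform is smooth and may be
differentiated under the integral. -/
def HasMoments (G : E → V) : Prop := ∀ p : ℕ, Integrable fun z => ‖z‖ ^ p • G z

namespace HasMoments

variable {G : E → V}

lemma integrable (hG : HasMoments G) : Integrable G := by
  simpa only [pow_zero, one_smul] using hG 0

lemma integrable_norm_pow_mul (hG : HasMoments G) (p : ℕ) :
    Integrable fun z => ‖z‖ ^ p * ‖G z‖ := by
  simpa only [norm_smul, norm_pow, norm_norm] using (hG p).norm

lemma inner_smul (hG : HasMoments G) (v : E) :
    HasMoments fun z => (Complex.I * ⟪z, v⟫) • G z := fun p => by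
  have hm : AEStronglyMeasurable (fun z => ‖z‖ ^ p • (Complex.I * ⟪z, v⟫) • G z) := by
    have := hG.integrable.aestronglyMeasurable
    have hc : Continuous fun z : E => Complex.I * ⟪z, v⟫ := by fun_prop
    exact (continuous_norm.pow p).aestronglyMeasurable.smul (hc.aestronglyMeasurable.smul this)
  refine ((hG.integrable_norm_pow_mul (p + 1)).mul_const ‖v‖).mono' hm (ae_of_all _ fun z => ?_)
  have hv : ‖⟪z, v⟫‖ ≤ ‖z‖ * ‖v‖ := norm_inner_le_norm z v
  calc ‖‖z‖ ^ p • (Complex.I * ⟪z, v⟫) • G z‖ = ‖z‖ ^ p * (‖⟪z, v⟫‖ * ‖G z‖) := by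
        simp only [norm_smul, norm_mul, norm_pow, norm_norm, Complex.norm_I, one_mul,
          Complex.norm_real]
    _ ≤ ‖z‖ ^ p * (‖z‖ * ‖v‖ * ‖G z‖) := by gcongr
    _ = ‖z‖ ^ (p + 1) * ‖G z‖ * ‖v‖ := by ring

lemma contDiff_invFourierInt (hG : HasMoments G) : ContDiff ℝ ∞ (invFourierInt G) := by
  rw [funext (invFourierInt_eq_fourier G)]
  exact (Real.contDiff_fourier fun p _ => hG.integrable_norm_pow_mul p).comp
    (contDiff_const_smul _)

lemma lineDeriv_invFourierInt (hG : HasMoments G) (x v : E) :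
    lineDeriv ℝ (invFourierInt G) x v =
      invFourierInt (fun z => (Complex.I * ⟪z, v⟫) • G z) x := by
  have hvG := (hG.inner_smul v).integrable
  have h := (hasDerivAt_integral_of_dominated_loc_of_deriv_le (x₀ := (0 : ℝ)) univ_mem
    (F := fun t z => planeWave (x + t • v) z • G z)
    (F' := fun t z => planeWave (x + t • v) z • (Complex.I * ⟪z, v⟫) • G z)
    (Eventually.of_forall fun t => (integrable_planeWave_smul hG.integrable _).1)
    (integrable_planeWave_smul hG.integrable _) (integrable_planeWave_smul hvG _).1
    (ae_of_all _ fun z t _ => (by rw [norm_smul, norm_planeWave, one_mul])) hvG.norm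
    (ae_of_all _ fun z t _ => by
      simpa only [smul_smul, mul_comm (planeWave _ z)] using
        (hasDerivAt_planeWave x v z t).smul_const (G z))).2
  simp only [zero_smul, add_zero] at h
  exact h.deriv

end HasMoments

/-- The Fourier transform `z ↦ ∫ e^{-i⟨z, y⟩} f(y) dy` of a Schwartz function. -/
def fourierInt (f : 𝓢(E, V)) : 𝓢(E, V) :=
  SchwartzMap.compCLMOfContinuousLinearEquiv ℝ (ContinuousLinearEquiv.smulLeft
    (Units.mk0 (2 * Real.pi)⁻¹ (inv_ne_zero Real.two_pi_pos.ne'))) (𝓕 f)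

lemma fourierInt_eq_fourier (f : 𝓢(E, V)) (z : E) :
    fourierInt f z = 𝓕 (f : E → V) ((2 * Real.pi)⁻¹ • z) := by
  rw [← SchwartzMap.fourier_coe]
  rfl

lemma fourierInt_apply (f : 𝓢(E, V)) (z : E) : fourierInt f z = invFourierInt f (-z) := by
  rw [fourierInt_eq_fourier, invFourierInt_eq_fourier, smul_neg, neg_smul, neg_neg]

lemma invFourierInt_fourierInt [CompleteSpace V] (f : 𝓢(E, V)) (x : E) :
    invFourierInt (fourierInt f) x = (2 * Real.pi) ^ Module.finrank ℝ E • f x := by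
  have hpi : 2 * Real.pi ≠ 0 := Real.two_pi_pos.ne'
  have hinv : 𝓕⁻ (𝓕 (f : E → V)) = f := by
    refine f.continuous.fourierInv_fourier_eq f.integrable ?_
    rw [← SchwartzMap.fourier_coe]
    exact (𝓕 f).integrable
  calc invFourierInt (fourierInt f) x
      = ∫ z, (fun v => planeWave x ((2 * Real.pi) • v) • 𝓕 (f : E → V) v)
          ((2 * Real.pi)⁻¹ • z) := by
        simp only [invFourierInt, smul_smul, mul_inv_cancel₀ hpi, one_smul, fourierInt_eq_fourier]
    _ = (2 * Real.pi) ^ Module.finrank ℝ E •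
          ∫ v, planeWave x ((2 * Real.pi) • v) • 𝓕 (f : E → V) v := by
        rw [Measure.integral_comp_smul volume
          (fun v => planeWave x ((2 * Real.pi) • v) • 𝓕 (f : E → V) v), inv_pow, inv_inv,
          abs_of_pos (by positivity)]
    _ = (2 * Real.pi) ^ Module.finrank ℝ E • 𝓕⁻ (𝓕 (f : E → V)) x := by
        rw [Real.fourierInv_eq']
        simp only [planeWave, inner_smul_right, real_inner_comm x]
    _ = _ := by rw [hinv]

end Fourier

section Homogeneity

variable {n : ℕ} {lv : Fin n → ℕ}

/-- The weight `1 / (2ℓ_k)` of the `k`-th coordinate, normalized so that `σ` has degree `1`. -/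
def wt (lv : Fin n → ℕ) (k : Fin n) : ℝ := (2 * lv k : ℝ)⁻¹

/-- The homogeneous dimension `∑_k 1 / (2ℓ_k)`, which is `‖γ‖ / (2ℓ)`. -/
def homDim (lv : Fin n → ℕ) : ℝ := ∑ k, wt lv k

/-- The anisotropic dilation by `s`, under which `σ` has degree `1`. -/
def dil (lv : Fin n → ℕ) (s : ℝ) (z : EuclideanSpace ℝ (Fin n)) : EuclideanSpace ℝ (Fin n) :=
  WithLp.toLp 2 fun k => s ^ wt lv k * z k

@[simp]
lemma dil_apply (lv : Fin n → ℕ) (s : ℝ) (z : EuclideanSpace ℝ (Fin n)) (k : Fin n) :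
    dil lv s z k = s ^ wt lv k * z k := rfl

lemma wt_pos (hlv : ∀ k, 0 < lv k) (k : Fin n) : 0 < wt lv k := by
  have := hlv k
  unfold wt
  positivity

lemma wt_mul_two_mul (hlv : ∀ k, 0 < lv k) (k : Fin n) : wt lv k * (2 * lv k : ℕ) = 1 := by
  have := (hlv k).ne'
  unfold wt
  push_cast
  field_simp

lemma wt_lt_one (hlv : ∀ k, 0 < lv k) (k : Fin n) : wt lv k < 1 := by
  have : (1 : ℝ) ≤ lv k := by exact_mod_cast hlv k
  exact inv_lt_one_of_one_lt₀ (by linarith)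

lemma homDim_pos [NeZero n] (hlv : ∀ k, 0 < lv k) : 0 < homDim lv :=
  Finset.sum_pos (fun k _ => wt_pos hlv k) Finset.univ_nonempty

lemma homDim_nonneg (hlv : ∀ k, 0 < lv k) : 0 ≤ homDim lv :=
  Finset.sum_nonneg fun k _ => (wt_pos hlv k).le

lemma dil_add (lv : Fin n → ℕ) (s : ℝ) (z w : EuclideanSpace ℝ (Fin n)) :
    dil lv s (z + w) = dil lv s z + dil lv s w := by
  ext k
  simp only [dil_apply, PiLp.add_apply, mul_add]

lemma dil_smul_single (lv : Fin n → ℕ) (s t : ℝ) (k : Fin n) :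
    dil lv s (t • EuclideanSpace.single k 1) = t • s ^ wt lv k • EuclideanSpace.single k 1 := by
  ext j
  obtain rfl | h := eq_or_ne j k <;> simp [*, mul_comm]

lemma dil_zero (lv : Fin n → ℕ) (s : ℝ) : dil lv s 0 = 0 := by
  ext k
  simp

lemma dil_dil_inv (lv : Fin n → ℕ) {s : ℝ} (hs : 0 < s) (z : EuclideanSpace ℝ (Fin n)) :
    dil lv s (dil lv s⁻¹ z) = z := by
  ext k
  rw [dil_apply, dil_apply, Real.inv_rpow hs.le,
    mul_inv_cancel_left₀ (Real.rpow_pos_of_pos hs _).ne']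

lemma abs_dil_inv_apply (lv : Fin n → ℕ) {s : ℝ} (hs : 0 < s) (z : EuclideanSpace ℝ (Fin n))
    (k : Fin n) : |dil lv s⁻¹ z k| = (s ^ wt lv k)⁻¹ * |z k| := by
  rw [dil_apply, Real.inv_rpow hs.le, abs_mul, abs_of_nonneg (by positivity)]

lemma sigma_nonneg (lv : Fin n → ℕ) (z : EuclideanSpace ℝ (Fin n)) : 0 ≤ sigma lv z :=
  Finset.sum_nonneg fun _ _ => (even_two_mul _).pow_nonneg _

lemma coord_pow_le_sigma (lv : Fin n → ℕ) (z : EuclideanSpace ℝ (Fin n)) (k : Fin n) :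
    z k ^ (2 * lv k) ≤ sigma lv z :=
  Finset.single_le_sum (f := fun k => z k ^ (2 * lv k))
    (fun _ _ => (even_two_mul _).pow_nonneg _) (Finset.mem_univ k)

lemma exists_coord_ne_zero {z : EuclideanSpace ℝ (Fin n)} (hz : z ≠ 0) : ∃ k, z k ≠ 0 := by
  by_contra! h
  exact hz (PiLp.ext h)

lemma sigma_pos {z : EuclideanSpace ℝ (Fin n)} (hz : z ≠ 0) : 0 < sigma lv z := by
  obtain ⟨k, hk⟩ := exists_coord_ne_zero hz
  exact ((even_two_mul _).pow_pos hk).trans_le (coord_pow_le_sigma lv z k)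

lemma sigma_single (hlv : ∀ k, 0 < lv k) (k : Fin n) (t : ℝ) :
    sigma lv (t • EuclideanSpace.single k 1) = t ^ (2 * lv k) := by
  rw [sigma, Finset.sum_eq_single_of_mem k (Finset.mem_univ k) fun j _ hj => ?_]
  · simp
  · simp [hj, (hlv j).ne']

lemma sigma_zero (hlv : ∀ k, 0 < lv k) : sigma lv 0 = 0 :=
  Finset.sum_eq_zero fun k _ => by simp [(hlv k).ne']

lemma contDiff_sigma (lv : Fin n → ℕ) : ContDiff ℝ ∞ (sigma lv) :=
  ContDiff.sum fun k _ => (EuclideanSpace.proj (𝕜 := ℝ) k).contDiff.pow _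

lemma measurable_sigma (lv : Fin n → ℕ) : Measurable (sigma lv) :=
  (contDiff_sigma lv).continuous.measurable

lemma sigma_dil (hlv : ∀ k, 0 < lv k) {s : ℝ} (hs : 0 < s) (z : EuclideanSpace ℝ (Fin n)) :
    sigma lv (dil lv s z) = s * sigma lv z := by
  simp only [sigma, dil_apply, mul_pow, Finset.mul_sum]
  refine Finset.sum_congr rfl fun k _ => ?_
  rw [← Real.rpow_mul_natCast hs.le, wt_mul_two_mul hlv, Real.rpow_one]

lemma isCompact_sigma_eq_one (hlv : ∀ k, 0 < lv k) :
    IsCompact {z : EuclideanSpace ℝ (Fin n) | sigma lv z = 1} := by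
  have hbox : IsCompact ((EuclideanSpace.equiv (Fin n) ℝ).toHomeomorph ⁻¹'
      (univ.pi fun _ => Icc (-1) 1)) :=
    (Homeomorph.isCompact_preimage _).2 (isCompact_univ_pi fun _ => isCompact_Icc)
  refine hbox.of_isClosed_subset (isClosed_eq (contDiff_sigma lv).continuous continuous_const)
    fun z (hz : sigma lv z = 1) k _ => abs_le.1 ?_
  have hk := (even_two_mul (lv k)).pow_abs (z k) ▸ hz ▸ coord_pow_le_sigma lv z k
  exact (pow_le_one_iff_of_nonneg (abs_nonneg _) (mul_ne_zero two_ne_zero (hlv k).ne')).1 hk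

variable {V : Type*} [NormedAddCommGroup V] [NormedSpace ℝ V]

/-- `g` is smooth away from the origin and homogeneous of degree `d` under the dilations `dil`. -/
structure IsHom (lv : Fin n → ℕ) (d : ℝ) (g : EuclideanSpace ℝ (Fin n) → V) : Prop where
  contDiffOn : ContDiffOn ℝ ∞ g {0}ᶜ
  map_dil : ∀ s > 0, ∀ z, g (dil lv s z) = s ^ d • g z

lemma isHom_sigma (hlv : ∀ k, 0 < lv k) : IsHom lv 1 (sigma lv) where
  contDiffOn := (contDiff_sigma lv).contDiffOn
  map_dil s hs z := by rw [sigma_dil hlv hs, Real.rpow_one, smul_eq_mul]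

namespace IsHom

variable {d e : ℝ} {g : EuclideanSpace ℝ (Fin n) → V}

lemma smul {c : EuclideanSpace ℝ (Fin n) → ℝ} (hc : IsHom lv e c) (hg : IsHom lv d g) :
    IsHom lv (e + d) fun z => c z • g z where
  contDiffOn := hc.contDiffOn.smul hg.contDiffOn
  map_dil s hs z := by
    rw [hc.map_dil s hs, hg.map_dil s hs, Real.rpow_add hs, smul_eq_mul, smul_smul, smul_smul]
    ring_nf

lemma sigma_pow_smul (hlv : ∀ k, 0 < lv k) (hg : IsHom lv d g) (p : ℕ) :
    IsHom lv (p + d) fun z => sigma lv z ^ p • g z where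
  contDiffOn := ((contDiff_sigma lv).pow p).contDiffOn.smul hg.contDiffOn
  map_dil s hs z := by
    rw [sigma_dil hlv hs, hg.map_dil s hs, Real.rpow_add hs, Real.rpow_natCast, smul_smul,
      smul_smul]
    ring_nf

lemma map_zero (hd : d ≠ 0) (hg : IsHom lv d g) : g 0 = 0 := by
  have h := hg.map_dil 2 two_pos 0
  rw [dil_zero, eq_comm, ← sub_eq_zero, ← one_smul ℝ (g 0), smul_smul, ← sub_smul, mul_one] at h
  refine (smul_eq_zero.1 h).resolve_left (sub_ne_zero.2 fun h2 => hd ?_)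
  exact (Real.rpow_right_inj two_pos (by norm_num)).1 (h2.trans (Real.rpow_zero 2).symm)

lemma measurable [MeasurableSpace V] [BorelSpace V] (hg : IsHom lv d g) : Measurable g :=
  measurable_of_continuousOn_compl_singleton 0 hg.contDiffOn.continuousOn

lemma differentiableAt (hg : IsHom lv d g) {z : EuclideanSpace ℝ (Fin n)} (hz : z ≠ 0) :
    DifferentiableAt ℝ g z :=
  (hg.contDiffOn.contDiffAt (isOpen_compl_singleton.mem_nhds hz)).differentiableAt (by simp)

lemma exists_norm_le (hlv : ∀ k, 0 < lv k) (hg : IsHom lv d g) :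
    ∃ C ≥ 0, ∀ z, ‖g z‖ ≤ C * sigma lv z ^ d := by
  obtain ⟨C, hC⟩ := (isCompact_sigma_eq_one hlv).exists_bound_of_continuousOn
    (hg.contDiffOn.continuousOn.mono fun z (hz : sigma lv z = 1) (h0 : z = 0) => by
      rw [h0, sigma_zero hlv] at hz
      exact zero_ne_one hz)
  refine ⟨max C ‖g 0‖, le_max_of_le_right (norm_nonneg _), fun z => ?_⟩
  obtain rfl | hz := eq_or_ne z 0
  · obtain rfl | hd := eq_or_ne d 0
    · simp
    · simp [hg.map_zero hd, sigma_zero hlv, hd]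
  · have hσ := sigma_pos (lv := lv) hz
    have hs : sigma lv (dil lv (sigma lv z)⁻¹ z) = 1 := by
      rw [sigma_dil hlv (inv_pos.2 hσ), inv_mul_cancel₀ hσ.ne']
    calc ‖g z‖ = sigma lv z ^ d * ‖g (dil lv (sigma lv z)⁻¹ z)‖ := by
          rw [← Real.norm_of_nonneg (Real.rpow_nonneg hσ.le d), ← norm_smul,
            ← hg.map_dil _ hσ, dil_dil_inv lv hσ]
      _ ≤ sigma lv z ^ d * max C ‖g 0‖ := by
          gcongr
          exact (hC _ hs).trans (le_max_left _ _)
      _ = _ := mul_comm _ _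

lemma lineDeriv_single (hg : IsHom lv d g) (k : Fin n) :
    IsHom lv (d - wt lv k) fun z => lineDeriv ℝ g z (EuclideanSpace.single k 1) where
  contDiffOn := by
    have h : ContDiffOn ℝ ∞ (fun z => fderiv ℝ g z (EuclideanSpace.single k 1)) {0}ᶜ :=
      (hg.contDiffOn.fderiv_of_isOpen isOpen_compl_singleton (by simp)).clm_apply contDiffOn_const
    exact h.congr fun z hz => (hg.differentiableAt hz).lineDeriv_eq_fderiv
  map_dil s hs z := by
    have hw : s ^ wt lv k ≠ 0 := (Real.rpow_pos_of_pos hs _).ne'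
    have h : lineDeriv ℝ g (dil lv s z) (s ^ wt lv k • EuclideanSpace.single k 1) =
        s ^ d • lineDeriv ℝ g z (EuclideanSpace.single k 1) := by
      simp only [lineDeriv, ← dil_smul_single, ← dil_add, hg.map_dil s hs]
      rw [deriv_fun_const_smul_field]
    rw [lineDeriv_smul] at h
    rw [Real.rpow_sub hs, div_eq_inv_mul, mul_smul, ← h, inv_smul_smul₀ hw]

lemma hasLineDerivAt_single (hlv : ∀ k, 0 < lv k) (hg : IsHom lv d g) {k : Fin n}
    (hk : wt lv k < d) (z : EuclideanSpace ℝ (Fin n)) :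
    HasLineDerivAt ℝ g (lineDeriv ℝ g z (EuclideanSpace.single k 1)) z
      (EuclideanSpace.single k 1) := by
  obtain rfl | hz := eq_or_ne z 0
  · obtain ⟨C, -, hC⟩ := hg.exists_norm_le hlv
    have hw := wt_pos hlv k
    rw [(hg.lineDeriv_single k).map_zero (sub_pos.2 hk).ne']
    have hgt (t : ℝ) : ‖g (0 + t • EuclideanSpace.single k 1)‖ ≤ C * |t| ^ (d / wt lv k) := by
      refine (hC _).trans_eq ?_
      rw [zero_add, sigma_single hlv, ← (even_two_mul _).pow_abs,
        ← Real.rpow_natCast_mul (abs_nonneg t), div_eq_mul_inv, mul_comm d,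
        eq_inv_of_mul_eq_one_right (wt_mul_two_mul hlv k)]
    have hp : 0 < d / wt lv k - 1 := sub_pos.2 ((one_lt_div hw).2 hk)
    have hlim : Tendsto (fun t : ℝ => C * |t| ^ (d / wt lv k - 1)) (𝓝 0) (𝓝 0) := by
      have := (continuous_abs.rpow_const fun _ => Or.inr hp.le).const_mul C |>.tendsto (0 : ℝ)
      simpa [Real.zero_rpow hp.ne'] using this
    refine hasDerivAt_iff_tendsto.2 (squeeze_zero (fun t => by positivity) (fun t => ?_) hlim)
    rw [zero_smul, add_zero, hg.map_zero (hw.trans hk).ne', smul_zero, sub_zero, sub_zero, sub_zero,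
      Real.norm_eq_abs]
    obtain rfl | ht := eq_or_ne t 0
    · simp [Real.zero_rpow hp.ne']
    · have ht' := abs_pos.2 ht
      rw [inv_mul_le_iff₀ ht', Real.rpow_sub_one ht'.ne', mul_left_comm, mul_div_cancel₀ _ ht'.ne']
      exact hgt t
  · exact (hg.differentiableAt hz).lineDifferentiableAt.hasLineDerivAt

end IsHom

end Homogeneity

section Integrability

variable {n : ℕ} {lv : Fin n → ℕ}

lemma integrable_prod_coord {h : Fin n → ℝ → ℝ} (hh : ∀ k, Integrable (h k)) :
    Integrable fun z : EuclideanSpace ℝ (Fin n) => ∏ k, h k (z k) :=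
  ((PiLp.volume_preserving_ofLp (Fin n)).integrable_comp_emb
    (MeasurableEquiv.toLp 2 (Fin n → ℝ)).symm.measurableEmbedding).2 (Integrable.fintype_prod hh)

lemma ae_coord_ne_zero : ∀ᵐ z : EuclideanSpace ℝ (Fin n), ∀ k, z k ≠ 0 := by
  refine ae_all_iff.2 fun k => ?_
  have h : LinearMap.ker (EuclideanSpace.proj (𝕜 := ℝ) k).toLinearMap ≠ ⊤ := fun h => by
    simpa using LinearMap.ext_iff.1 (LinearMap.ker_eq_top.1 h) (EuclideanSpace.single k 1)
  exact measure_eq_zero_iff_ae_notMem.1 (Measure.addHaar_submodule volume _ h)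

lemma integrable_abs_rpow_mul_exp_neg {p : ℕ} (hp : 0 < p) {b c : ℝ} (hb : -1 < b)
    (hc : 0 < c) : Integrable fun x : ℝ => |x| ^ b * Real.exp (-c * x ^ (2 * p)) := by
  have hp' : (0 : ℝ) < (2 * p : ℕ) := by positivity
  have h := integral_comp_abs (f := fun x => x ^ b * Real.exp (-c * x ^ ((2 * p : ℕ) : ℝ)))
  rw [integral_rpow_mul_exp_neg_mul_rpow hp' hb hc] at h
  simp only [Real.rpow_natCast, (even_two_mul p).pow_abs] at h
  refine .of_integral_ne_zero (h.trans_ne ?_)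
  have := Real.Gamma_pos_of_pos (div_pos (neg_lt_iff_pos_add.1 hb) hp')
  positivity

lemma integrable_sigma_rpow_mul_exp_neg_of_nonpos (hlv : ∀ k, 0 < lv k) {d c : ℝ}
    (hd : -homDim lv < d) (hd' : d ≤ 0) (hc : 0 < c) :
    Integrable fun z => sigma lv z ^ d * Real.exp (-c * sigma lv z) := by
  obtain hQ | hQ := le_or_gt (homDim lv) 0
  · linarith
  set b := d / homDim lv
  have hb : b ≤ 0 := div_nonpos_of_nonpos_of_nonneg hd' hQ.le
  have hb' : -1 < b := by rwa [lt_div_iff₀ hQ, neg_one_mul]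
  refine (integrable_prod_coord fun k =>
    integrable_abs_rpow_mul_exp_neg (hlv k) hb' hc).mono' ?_ ?_
  · have := measurable_sigma lv
    exact ((this.pow_const d).mul (this.const_mul _).exp).aestronglyMeasurable
  filter_upwards [ae_coord_ne_zero] with z hz
  have hσ := sigma_nonneg lv z
  have hk (k : Fin n) : |z k| ≤ sigma lv z ^ wt lv k := by
    rw [← Real.rpow_one |z k|, ← wt_mul_two_mul hlv k, mul_comm,
      Real.rpow_natCast_mul (abs_nonneg _), (even_two_mul _).pow_abs]
    exact Real.rpow_le_rpow ((even_two_mul _).pow_nonneg _) (coord_pow_le_sigma lv z k)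
      (wt_pos hlv k).le
  rw [Real.norm_of_nonneg (by positivity), Finset.prod_mul_distrib, ← Real.exp_sum,
    ← Finset.mul_sum]
  refine mul_le_mul_of_nonneg_right ?_ (Real.exp_pos _).le
  calc sigma lv z ^ d = ∏ k, (sigma lv z ^ wt lv k) ^ b := by
        rw [Real.finsetProd_rpow _ _ fun k _ => by positivity,
          ← Real.rpow_sum_of_nonneg hσ fun k _ => (wt_pos hlv k).le, ← Real.rpow_mul hσ]
        exact congrArg _ (mul_div_cancel₀ d hQ.ne').symm
    _ ≤ ∏ k, |z k| ^ b := Finset.prod_le_prod (fun k _ => by positivity) fun k _ =>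
        Real.rpow_le_rpow_of_nonpos (abs_pos.2 (hz k)) (hk k) hb

lemma rpow_le_mul_exp {u d c : ℝ} (hu : 0 ≤ u) (hd : 0 ≤ d) (hc : 0 < c) :
    u ^ d ≤ (d / c) ^ d * Real.exp (c * u) := by
  obtain rfl | hd := hd.eq_or_lt
  · simpa using mul_nonneg hc.le hu
  calc u ^ d = (d / c * (c * u / d)) ^ d := by field_simp
    _ ≤ (d / c * Real.exp (c * u / d)) ^ d := by
        gcongr
        linarith [Real.add_one_le_exp (c * u / d)]
    _ = (d / c) ^ d * Real.exp (c * u) := by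
        rw [Real.mul_rpow (by positivity) (by positivity), ← Real.exp_mul,
          div_mul_cancel₀ _ hd.ne']

lemma integrable_sigma_rpow_mul_exp_neg (hlv : ∀ k, 0 < lv k) {d c : ℝ} (hd : -homDim lv < d)
    (hc : 0 < c) : Integrable fun z => sigma lv z ^ d * Real.exp (-c * sigma lv z) := by
  obtain hd' | hd' := le_or_gt d 0
  · exact integrable_sigma_rpow_mul_exp_neg_of_nonpos hlv hd hd' hc
  obtain rfl | hn := eq_or_ne n 0
  · exact .of_finite
  have := NeZero.mk hn
  have h0 := integrable_sigma_rpow_mul_exp_neg_of_nonpos hlv (neg_lt_zero.2 (homDim_pos hlv))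
    le_rfl (half_pos hc)
  refine (h0.const_mul ((d / (c / 2)) ^ d)).mono' ?_ (ae_of_all _ fun z => ?_)
  · have := measurable_sigma lv
    exact ((this.pow_const d).mul (this.const_mul _).exp).aestronglyMeasurable
  have hσ := sigma_nonneg lv z
  rw [Real.norm_of_nonneg (by positivity), Real.rpow_zero, one_mul]
  calc sigma lv z ^ d * Real.exp (-c * sigma lv z)
      ≤ (d / (c / 2)) ^ d * Real.exp (c / 2 * sigma lv z) * Real.exp (-c * sigma lv z) := by
        gcongr
        exact rpow_le_mul_exp hσ hd'.le (half_pos hc)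
    _ = (d / (c / 2)) ^ d * Real.exp (-(c / 2) * sigma lv z) := by
        rw [mul_assoc, ← Real.exp_add]
        ring_nf

namespace IsHom

variable {d : ℝ} {g : EuclideanSpace ℝ (Fin n) → ℂ}

lemma integrable_exp_neg_smul (hlv : ∀ k, 0 < lv k) (hg : IsHom lv d g) (hd : -homDim lv < d)
    {s : ℝ} (hs : 0 < s) : Integrable fun z => Real.exp (-(s * sigma lv z)) • g z := by
  obtain ⟨C, -, hC⟩ := hg.exists_norm_le hlv
  refine ((integrable_sigma_rpow_mul_exp_neg hlv hd hs).const_mul C).mono' ?_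
    (ae_of_all _ fun z => ?_)
  · exact (((measurable_sigma lv).const_mul s).neg.exp.smul
      hg.measurable).aestronglyMeasurable
  · rw [norm_smul, Real.norm_of_nonneg (Real.exp_pos _).le, mul_comm, ← mul_assoc, neg_mul]
    gcongr
    exact hC z

/-- Near the origin `ψ` is bounded and `g` is integrable; away from it `g` is bounded and `ψ` is
integrable. -/
lemma integrable_mul (hlv : ∀ k, 0 < lv k) (hg : IsHom lv d g) (hd : -homDim lv < d)
    (hd' : d ≤ 0) {ψ : EuclideanSpace ℝ (Fin n) → ℂ} (hψ : Integrable ψ) {M : ℝ}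
    (hM : ∀ z, ‖ψ z‖ ≤ M) :
    Integrable fun z => g z * ψ z := by
  obtain ⟨C, hC0, hC⟩ := hg.exists_norm_le hlv
  have hint := ((integrable_sigma_rpow_mul_exp_neg hlv hd one_pos).const_mul
    (Real.exp 1 * M)).add hψ.norm |>.const_mul C
  refine hint.mono' (hg.measurable.aestronglyMeasurable.mul hψ.1) (ae_of_all _ fun z => ?_)
  have hM0 := (norm_nonneg _).trans (hM z)
  have hσ := sigma_nonneg lv z
  have hsum : sigma lv z ^ d * ‖ψ z‖ ≤
      Real.exp 1 * M * (sigma lv z ^ d * Real.exp (-1 * sigma lv z)) + ‖ψ z‖ := by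
    obtain h | h := le_or_gt (sigma lv z) 1
    · have : (1 : ℝ) ≤ Real.exp 1 * Real.exp (-1 * sigma lv z) := by
        rw [← Real.exp_add]
        exact Real.one_le_exp (by linarith)
      calc sigma lv z ^ d * ‖ψ z‖ ≤ sigma lv z ^ d * M * 1 := by
            rw [mul_one]
            gcongr
            exact hM z
        _ ≤ sigma lv z ^ d * M * (Real.exp 1 * Real.exp (-1 * sigma lv z)) := by gcongr
        _ ≤ _ := by linarith [norm_nonneg (ψ z)]
    · have : sigma lv z ^ d ≤ 1 := Real.rpow_le_one_of_one_le_of_nonpos h.le hd'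
      have := mul_le_of_le_one_left (norm_nonneg (ψ z)) this
      have : 0 ≤ Real.exp 1 * M * (sigma lv z ^ d * Real.exp (-1 * sigma lv z)) := by positivity
      linarith
  calc ‖g z * ψ z‖ ≤ C * sigma lv z ^ d * ‖ψ z‖ := by
        rw [norm_mul]
        gcongr
        exact hC z
    _ ≤ C * (Real.exp 1 * M * (sigma lv z ^ d * Real.exp (-1 * sigma lv z)) + ‖ψ z‖) := by
        rw [mul_assoc]
        gcongr

end IsHom

end Integrability

section HeatKernel

variable {n : ℕ} {lv : Fin n → ℕ}

lemma map_dil_volume (lv : Fin n → ℕ) {s : ℝ} (hs : 0 < s) :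
    Measure.map (dil lv s) volume = ENNReal.ofReal (s ^ homDim lv)⁻¹ • volume := by
  let b := (EuclideanSpace.basisFun (Fin n) ℝ).toBasis
  let D := Matrix.toLin b b (Matrix.diagonal fun k => s ^ wt lv k)
  have hD : ⇑D = dil lv s := by
    ext z k
    simp [D, b, Matrix.toLin_apply, Matrix.mulVec_diagonal, Pi.single_apply]
  have hdet : LinearMap.det D = s ^ homDim lv := by
    rw [LinearMap.det_toLin, Matrix.det_diagonal, homDim, Real.rpow_sum_of_pos hs]
  have hpos := Real.rpow_pos_of_pos hs (homDim lv)
  rw [← hD, Measure.map_linearMap_addHaar_eq_smul_addHaar _ (hdet ▸ hpos.ne'), hdet,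
    abs_of_pos (inv_pos.2 hpos)]

lemma measurableEmbedding_dil (lv : Fin n → ℕ) {s : ℝ} (hs : 0 < s) :
    MeasurableEmbedding (dil lv s) := by
  refine Continuous.measurableEmbedding ?_
    (Function.LeftInverse.injective (g := dil lv s⁻¹) fun z => ?_)
  · unfold dil
    fun_prop
  · simpa using dil_dil_inv lv (inv_pos.2 hs) z

lemma integral_comp_dil {V : Type*} [NormedAddCommGroup V] [NormedSpace ℝ V] (lv : Fin n → ℕ)
    {s : ℝ} (hs : 0 < s) (f : EuclideanSpace ℝ (Fin n) → V) :
    ∫ z, f (dil lv s z) = (s ^ homDim lv)⁻¹ • ∫ z, f z := by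
  rw [← (measurableEmbedding_dil lv hs).integral_map, map_dil_volume lv hs, integral_smul_measure,
    ENNReal.toReal_ofReal (by positivity)]

lemma integrable_comp_dil {V : Type*} [NormedAddCommGroup V] (lv : Fin n → ℕ)
    {s : ℝ} (hs : 0 < s) {f : EuclideanSpace ℝ (Fin n) → V} (hf : Integrable f) :
    Integrable fun z => f (dil lv s z) := by
  refine (measurableEmbedding_dil lv hs).integrable_map_iff.1 ?_
  rw [map_dil_volume lv hs]
  exact hf.smul_measure ENNReal.ofReal_ne_top

lemma planeWave_dil (lv : Fin n → ℕ) (s : ℝ) (x z : EuclideanSpace ℝ (Fin n)) :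
    planeWave x (dil lv s z) = planeWave (dil lv s x) z := by
  simp only [planeWave, PiLp.inner_apply, dil_apply, RCLike.inner_apply, conj_trivial]
  simp only [mul_assoc, mul_left_comm]

/-- The inverse Fourier integral of `e^{-sσ} g`, at the point `x`. For `g = σ L⁻¹` this is the
kernel `J(x, s)`. -/
def heatKernel (lv : Fin n → ℕ) (g : EuclideanSpace ℝ (Fin n) → ℂ)
    (x : EuclideanSpace ℝ (Fin n)) (s : ℝ) : ℂ :=
  invFourierInt (fun z => Real.exp (-(s * sigma lv z)) • g z) x

namespace IsHom

variable {d : ℝ} {g : EuclideanSpace ℝ (Fin n) → ℂ}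

lemma heatKernel_eq_smul (hlv : ∀ k, 0 < lv k) (hg : IsHom lv d g)
    (x : EuclideanSpace ℝ (Fin n)) {s : ℝ} (hs : 0 < s) :
    heatKernel lv g x s = s ^ (-(d + homDim lv)) • heatKernel lv g (dil lv s⁻¹ x) 1 := by
  have hs' := inv_pos.2 hs
  have h := integral_comp_dil lv hs' fun z =>
    planeWave x z • (Real.exp (-(s * sigma lv z)) • g z)
  simp only [sigma_dil hlv hs', hg.map_dil _ hs', planeWave_dil, mul_inv_cancel_left₀ hs.ne'] at h
  simp only [Real.inv_rpow hs.le, inv_inv] at h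
  rw [eq_comm, ← eq_inv_smul_iff₀ (by positivity)] at h
  simp only [heatKernel, invFourierInt, one_mul, h]
  rw [← integral_smul, ← integral_smul]
  refine integral_congr_ae (ae_of_all _ fun z => ?_)
  simp only [neg_add, Real.rpow_add hs, Real.rpow_neg hs.le, Complex.real_smul, smul_eq_mul]
  push_cast
  ring

lemma measurable_heatKernel (hg : IsHom lv d g) {α : Type*} [MeasurableSpace α]
    {X : α → EuclideanSpace ℝ (Fin n)} {T : α → ℝ} (hX : Measurable X) (hT : Measurable T) :
    Measurable fun a => heatKernel lv g (X a) (T a) := by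
  have hσ := measurable_sigma lv
  have hwave : Measurable fun q : α × EuclideanSpace ℝ (Fin n) => planeWave (X q.1) q.2 :=
    continuous_planeWave.measurable.comp ((hX.comp measurable_fst).prodMk measurable_snd)
  have hexp : Measurable fun q : α × EuclideanSpace ℝ (Fin n) =>
      Real.exp (-(T q.1 * sigma lv q.2)) :=
    ((hT.comp measurable_fst).mul (hσ.comp measurable_snd)).neg.exp
  exact (hwave.smul (hexp.smul
    (hg.measurable.comp measurable_snd))).stronglyMeasurable.integral_prod_right.measurable

lemma coord_mul_heatKernel (hlv : ∀ k, 0 < lv k) (hg : IsHom lv d g) {k : Fin n}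
    (hd : wt lv k < d) (x : EuclideanSpace ℝ (Fin n)) :
    Complex.I * x k * heatKernel lv g x 1 =
      heatKernel lv (fun z => lineDeriv ℝ (sigma lv) z (EuclideanSpace.single k 1) • g z) x 1 -
      heatKernel lv (fun z => lineDeriv ℝ g z (EuclideanSpace.single k 1)) x 1 := by
  have hQ := homDim_nonneg hlv
  have hw := wt_pos hlv k
  have hw1 := wt_lt_one hlv k
  have hσ := isHom_sigma hlv
  have hint := hg.integrable_exp_neg_smul hlv (by linarith) one_pos
  have hint₁ := (hg.lineDeriv_single k).integrable_exp_neg_smul hlv (by linarith) one_pos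
  have hint₂ := ((hσ.lineDeriv_single k).smul hg).integrable_exp_neg_smul hlv (by linarith) one_pos
  have h := invFourierInt_lineDeriv_eq (v := EuclideanSpace.single k 1) hint (hint₁.sub hint₂)
    (fun z => ?_) x
  · have hsub := invFourierInt_sub hint₁ hint₂ x
    rw [EuclideanSpace.inner_single_right, conj_trivial, one_mul, hsub] at h
    rw [heatKernel, heatKernel, heatKernel]
    linear_combination h
  · refine HasDerivAt.congr_deriv (((hσ.hasLineDerivAt_single hlv hw1 z).const_mul 1).neg.exp.smul
      (hg.hasLineDerivAt_single hlv hd z)) ?_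
    simp [sub_eq_add_neg, mul_assoc]

lemma exists_abs_pow_mul_heatKernel_le (hlv : ∀ k, 0 < lv k) (k : Fin n) (N : ℕ) :
    ∀ {d : ℝ} {g : EuclideanSpace ℝ (Fin n) → ℂ}, IsHom lv d g → N * wt lv k < d →
      ∃ C, ∀ x, |x k| ^ N * ‖heatKernel lv g x 1‖ ≤ C := by
  have hw := wt_pos hlv k
  have hw1 := wt_lt_one hlv k
  induction N with
  | zero =>
    intro d g _ _
    exact ⟨_, fun x => (by rw [pow_zero, one_mul]; exact norm_invFourierInt_le _ x)⟩
  | succ N ih =>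
    intro d g hg hd
    push_cast at hd
    have hN : 0 ≤ N * wt lv k := by positivity
    obtain ⟨C₁, h₁⟩ := ih (hg.lineDeriv_single k) (by linarith)
    obtain ⟨C₂, h₂⟩ := ih (((isHom_sigma hlv).lineDeriv_single k).smul hg) (by linarith)
    refine ⟨C₂ + C₁, fun x => ?_⟩
    have h := congrArg norm (hg.coord_mul_heatKernel hlv (k := k) (by linarith) x)
    rw [norm_mul, norm_mul, Complex.norm_I, one_mul, Complex.norm_real, Real.norm_eq_abs] at h
    rw [pow_succ, mul_assoc, h]
    refine (mul_le_mul_of_nonneg_left (norm_sub_le _ _) (by positivity)).trans ?_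
    rw [mul_add]
    exact add_le_add (h₂ x) (h₁ x)

end IsHom

end HeatKernel

section Subordination

lemma integral_pow_mul_exp_neg_mul (p : ℕ) {τ : ℝ} (hτ : 0 < τ) :
    ∫ r in Ioi (0 : ℝ), r ^ p * τ ^ (p + 1) * Real.exp (-(r * τ)) = p.factorial := by
  have h := Real.integral_rpow_mul_exp_neg_mul_Ioi (a := p + 1) (by positivity) hτ
  simp only [add_sub_cancel_right, Real.rpow_natCast, Real.Gamma_nat_eq_factorial] at h
  simp only [mul_right_comm _ (τ ^ (p + 1)), integral_mul_const, mul_comm _ τ, h]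
  rw [mul_right_comm, ← Real.rpow_natCast τ, Nat.cast_succ, ← Real.mul_rpow (by positivity) hτ.le,
    one_div_mul_cancel hτ.ne', Real.one_rpow, one_mul]

variable {α : Type*} [MeasurableSpace α] {μ : Measure α} {τ : α → ℝ} {h : α → ℂ}

lemma integrable_subordination [SFinite μ] (hτm : Measurable τ) (hτ : ∀ᵐ a ∂μ, 0 < τ a)
    (hh : Integrable h μ) (p : ℕ) :
    Integrable (fun q : ℝ × α => (q.1 ^ p * τ q.2 ^ (p + 1) * Real.exp (-(q.1 * τ q.2))) • h q.2)
      ((volume.restrict (Ioi 0)).prod μ) := by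
  have hm : Measurable fun q : ℝ × α =>
      q.1 ^ p * τ q.2 ^ (p + 1) * Real.exp (-(q.1 * τ q.2)) := by fun_prop
  refine (integrable_prod_iff' (hm.aestronglyMeasurable.smul hh.1.comp_snd)).2 ⟨?_, ?_⟩
  · filter_upwards [hτ] with a ha
    have hint := integral_pow_mul_exp_neg_mul p ha
    exact (Integrable.of_integral_ne_zero (hint.trans_ne (by positivity))).smul_const (h a)
  · refine (hh.norm.const_mul (p.factorial : ℝ)).congr ?_
    filter_upwards [hτ] with a ha
    simp only [Pi.smul_apply', norm_smul]
    rw [integral_mul_const, ← integral_pow_mul_exp_neg_mul p ha]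
    congr 1
    refine setIntegral_congr_fun measurableSet_Ioi fun r (hr : 0 < r) => ?_
    exact (Real.norm_of_nonneg (by positivity)).symm

lemma integral_subordination [SFinite μ] (hτm : Measurable τ) (hτ : ∀ᵐ a ∂μ, 0 < τ a)
    (hh : Integrable h μ) (p : ℕ) :
    ∫ r in Ioi (0 : ℝ), ∫ a, (r ^ p * τ a ^ (p + 1) * Real.exp (-(r * τ a))) • h a ∂μ =
      p.factorial * ∫ a, h a ∂μ := by
  rw [integral_integral_swap (integrable_subordination hτm hτ hh p), ← integral_const_mul]
  refine integral_congr_ae ?_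
  filter_upwards [hτ] with a ha
  rw [integral_smul_const, integral_pow_mul_exp_neg_mul p ha, Complex.real_smul,
    Complex.ofReal_natCast]

end Subordination

section Decay

variable {n : ℕ} {lv : Fin n → ℕ}

lemma ae_sigma_pos [NeZero n] : ∀ᵐ z, 0 < sigma lv z :=
  (Measure.ae_ne volume 0).mono fun _ => sigma_pos

namespace IsHom

variable {d : ℝ} {g : EuclideanSpace ℝ (Fin n) → ℂ}

lemma integral_pow_mul_heatKernel [NeZero n] (hlv : ∀ k, 0 < lv k) (hg : IsHom lv d g)
    (hd : -homDim lv < d) (p : ℕ) (x : EuclideanSpace ℝ (Fin n)) {t : ℝ} (ht : 0 < t) :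
    ∫ r in Ioi (0 : ℝ), r ^ p * heatKernel lv (fun z => sigma lv z ^ (p + 1) • g z) x (t + r) =
      p.factorial * heatKernel lv g x t := by
  rw [heatKernel, invFourierInt, ← integral_subordination (measurable_sigma lv)
    ae_sigma_pos (integrable_planeWave_smul (hg.integrable_exp_neg_smul hlv hd ht) x) p]
  refine integral_congr_ae (ae_of_all _ fun r => ?_)
  simp only [heatKernel, invFourierInt]
  rw [← integral_const_mul]
  refine integral_congr_ae (ae_of_all _ fun z => ?_)
  simp only [add_mul, neg_add, Real.exp_add, Complex.real_smul, smul_eq_mul]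
  push_cast
  ring

end IsHom

lemma rpow_neg_one_add_inv_mul_le {s u b : ℝ} (hs : 1 ≤ s) (hu : 0 ≤ u) (hb : 0 ≤ b) :
    (1 + s⁻¹ * u) ^ (-b) ≤ s ^ b * (1 + u) ^ (-b) := by
  have hs0 : 0 < s := one_pos.trans_le hs
  calc (1 + s⁻¹ * u) ^ (-b) ≤ (s⁻¹ * (1 + u)) ^ (-b) := by
        refine Real.rpow_le_rpow_of_nonpos (by positivity) ?_ (neg_nonpos.2 hb)
        linarith [inv_le_one_of_one_le₀ hs]
    _ = s ^ b * (1 + u) ^ (-b) := by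
        rw [Real.mul_rpow (by positivity) (by positivity), Real.inv_rpow hs0.le,
          ← Real.rpow_neg hs0.le, neg_neg]

namespace IsHom

variable {d : ℝ} {g : EuclideanSpace ℝ (Fin n) → ℂ}

lemma exists_heatKernel_one_le_pow (hlv : ∀ k, 0 < lv k) (hg : IsHom lv d g) (k : Fin n) {N : ℕ}
    (hd : N * wt lv k < d) :
    ∃ C ≥ 0, ∀ x, ‖heatKernel lv g x 1‖ ≤ C * (1 + |x k|) ^ (-N : ℝ) := by
  have hw := wt_pos hlv k
  obtain ⟨C₀, h₀⟩ := hg.exists_abs_pow_mul_heatKernel_le hlv k 0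
    (lt_of_le_of_lt (by rw [Nat.cast_zero, zero_mul]; positivity) hd)
  obtain ⟨C₁, h₁⟩ := hg.exists_abs_pow_mul_heatKernel_le hlv k N hd
  simp only [pow_zero, one_mul] at h₀
  have hC₀ := (norm_nonneg _).trans (h₀ 0)
  have hC₁ := (mul_nonneg (by positivity) (norm_nonneg _)).trans (h₁ 0)
  refine ⟨2 ^ (N - 1) * (C₀ + C₁), by positivity, fun x => ?_⟩
  rw [Real.rpow_neg (by positivity), Real.rpow_natCast, ← div_eq_mul_inv,
    le_div_iff₀ (by positivity)]
  calc ‖heatKernel lv g x 1‖ * (1 + |x k|) ^ N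
      ≤ ‖heatKernel lv g x 1‖ * (2 ^ (N - 1) * (1 ^ N + |x k| ^ N)) := by
        gcongr
        exact add_pow_le zero_le_one (abs_nonneg _) N
    _ = 2 ^ (N - 1) * (‖heatKernel lv g x 1‖ + |x k| ^ N * ‖heatKernel lv g x 1‖) := by ring
    _ ≤ 2 ^ (N - 1) * (C₀ + C₁) := by gcongr <;> simp only [h₀, h₁]

lemma exists_heatKernel_le_of_one_le (hlv : ∀ k, 0 < lv k) (hg : IsHom lv d g) (k : Fin n)
    {a : ℝ} (ha : 0 ≤ a) (hd : a + wt lv k < d) :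
    ∃ C ≥ 0, ∀ x, ∀ s ≥ 1, ‖heatKernel lv g x s‖ ≤
      C * (1 + |x k|) ^ (-(a / wt lv k)) * s ^ (a - (d + homDim lv)) := by
  have hw := wt_pos hlv k
  have hN : ⌈a / wt lv k⌉₊ * wt lv k < d := by
    have := mul_lt_mul_of_pos_right (Nat.ceil_lt_add_one (div_nonneg ha hw.le)) hw
    rw [add_mul, div_mul_cancel₀ _ hw.ne'] at this
    linarith
  obtain ⟨C, hC0, hC⟩ := hg.exists_heatKernel_one_le_pow hlv k hN
  refine ⟨C, hC0, fun x s hs => ?_⟩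
  have hs0 : 0 < s := one_pos.trans_le hs
  have hs1 : 1 ≤ s ^ wt lv k := Real.one_le_rpow hs hw.le
  calc ‖heatKernel lv g x s‖
      = s ^ (-(d + homDim lv)) * ‖heatKernel lv g (dil lv s⁻¹ x) 1‖ := by
        rw [hg.heatKernel_eq_smul hlv x hs0, norm_smul, Real.norm_of_nonneg (by positivity)]
    _ ≤ s ^ (-(d + homDim lv)) * (C * (1 + |dil lv s⁻¹ x k|) ^ (-(a / wt lv k))) := by
        gcongr
        refine (hC _).trans ?_
        gcongr
        · linarith [abs_nonneg (dil lv s⁻¹ x k)]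
        · exact Nat.le_ceil _
    _ ≤ s ^ (-(d + homDim lv)) * (C * (s ^ a * (1 + |x k|) ^ (-(a / wt lv k)))) := by
        have h := rpow_neg_one_add_inv_mul_le hs1 (abs_nonneg (x k)) (div_nonneg ha hw.le)
        rw [← Real.rpow_mul hs0.le, mul_div_cancel₀ _ hw.ne', ← abs_dil_inv_apply lv hs0] at h
        gcongr
    _ = C * (1 + |x k|) ^ (-(a / wt lv k)) * s ^ (a - (d + homDim lv)) := by
        rw [sub_eq_neg_add, Real.rpow_add hs0]
        ring

/-- Subordination with `p` large reduces the case of a small degree `d` to that of a large one,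
where integration by parts applies. -/
lemma exists_heatKernel_one_le [NeZero n] (hlv : ∀ k, 0 < lv k) (hg : IsHom lv d g)
    (hd : -homDim lv < d) (k : Fin n) {a : ℝ} (ha : 0 ≤ a) (had : a < d + homDim lv) :
    ∃ C ≥ 0, ∀ x, ‖heatKernel lv g x 1‖ ≤ C * (1 + |x k|) ^ (-(a / wt lv k)) := by
  obtain ⟨p, hp⟩ := exists_nat_gt (a + wt lv k - d)
  obtain ⟨C, hC0, hC⟩ := (hg.sigma_pow_smul hlv (p + 1)).exists_heatKernel_le_of_one_le hlv k ha
    (by push_cast; linarith)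
  have hint : IntegrableOn (fun r : ℝ => (1 + r) ^ (a - (d + homDim lv) - 1)) (Ioi 0) := by
    simpa only [add_comm] using integrableOn_add_rpow_Ioi_of_lt (c := 0) (m := 1)
      (by linarith : a - (d + homDim lv) - 1 < -1) (by norm_num)
  set I := ∫ r in Ioi (0 : ℝ), (1 + r) ^ (a - (d + homDim lv) - 1)
  have hI : 0 ≤ I := setIntegral_nonneg measurableSet_Ioi fun r (hr : 0 < r) => by positivity
  refine ⟨C * I, by positivity, fun x => ?_⟩
  have hbound : ‖∫ r in Ioi (0 : ℝ),
      r ^ p * heatKernel lv (fun z => sigma lv z ^ (p + 1) • g z) x (1 + r)‖ ≤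
      C * (1 + |x k|) ^ (-(a / wt lv k)) * I := by
    rw [← integral_const_mul]
    refine norm_integral_le_of_norm_le (hint.const_mul _)
      ((ae_restrict_mem measurableSet_Ioi).mono fun r (hr : 0 < r) => ?_)
    rw [norm_mul, norm_pow, Complex.norm_real, Real.norm_of_nonneg hr.le]
    calc r ^ p * ‖heatKernel lv (fun z => sigma lv z ^ (p + 1) • g z) x (1 + r)‖
        ≤ (1 + r) ^ p * (C * (1 + |x k|) ^ (-(a / wt lv k)) *
          (1 + r) ^ (a - ((p + 1 : ℕ) + d + homDim lv))) := by
          gcongr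
          · linarith
          · exact hC x (1 + r) (by linarith)
      _ = C * (1 + |x k|) ^ (-(a / wt lv k)) * (1 + r) ^ (a - (d + homDim lv) - 1) := by
          rw [mul_left_comm, ← Real.rpow_natCast, ← Real.rpow_add (by positivity)]
          push_cast
          ring_nf
  rw [hg.integral_pow_mul_heatKernel hlv hd p x one_pos, norm_mul, Complex.norm_natCast] at hbound
  have hp0 : (1 : ℝ) ≤ p.factorial := by exact_mod_cast p.factorial_pos
  calc _ ≤ p.factorial * ‖heatKernel lv g x 1‖ := le_mul_of_one_le_left (norm_nonneg _) hp0
    _ ≤ _ := hbound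
    _ = _ := by ring

end IsHom

end Decay

section TimeIntegral

lemma integrableOn_Ioi_of_rpow_bounds {E : Type*} [NormedAddCommGroup E] {h : ℝ → E}
    (hm : AEStronglyMeasurable h (volume.restrict (Ioi 0))) {a b A B : ℝ} (ha : a < 1) (hb : 1 < b)
    (hA : ∀ t > 0, ‖h t‖ ≤ A * t ^ (-a)) (hB : ∀ t > 0, ‖h t‖ ≤ B * t ^ (-b)) :
    IntegrableOn h (Ioi 0) := by
  rw [← Ioc_union_Ioi_eq_Ioi zero_le_one]
  refine IntegrableOn.union ?_ ?_
  · have h₀ := (intervalIntegrable_iff_integrableOn_Ioc_of_le zero_le_one).1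
      (intervalIntegral.intervalIntegrable_rpow' (by linarith : -1 < -a))
    exact (h₀.const_mul A).mono' (hm.mono_set Ioc_subset_Ioi_self)
      ((ae_restrict_mem measurableSet_Ioc).mono fun t ht => hA t ht.1)
  · have h₁ := integrableOn_Ioi_rpow_of_lt (neg_lt_neg hb) one_pos
    exact (h₁.const_mul B).mono' (hm.mono_set (Ioi_subset_Ioi zero_le_one))
      ((ae_restrict_mem measurableSet_Ioi).mono fun t ht => hB t (one_pos.trans ht))

variable {n : ℕ} {lv : Fin n → ℕ}

namespace IsHom

variable {d : ℝ} {g : EuclideanSpace ℝ (Fin n) → ℂ}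

lemma integrable_heatKernel_one [NeZero n] (hlv : ∀ k, 0 < lv k) (hg : IsHom lv d g)
    (hd : 0 < d) : Integrable fun x => heatKernel lv g x 1 := by
  have hQ := homDim_pos hlv
  have hdecay (k : Fin n) := hg.exists_heatKernel_one_le hlv (by linarith) k
    (a := homDim lv + d / 2) (by positivity) (by linarith)
  choose C hC0 hC using hdecay
  have hr : (1 : ℝ) < (homDim lv + d / 2) / homDim lv := (one_lt_div hQ).2 (by linarith)
  refine (integrable_prod_coord fun k => (integrable_one_add_norm (E := ℝ) (μ := volume)
    (by simpa using hr)).const_mul (C k ^ (wt lv k / homDim lv))).mono'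
    (hg.measurable_heatKernel measurable_id measurable_const).aestronglyMeasurable
    (ae_of_all _ fun x => ?_)
  calc ‖heatKernel lv g x 1‖ = ∏ k, ‖heatKernel lv g x 1‖ ^ (wt lv k / homDim lv) := by
        rw [← Real.rpow_sum_of_nonneg (norm_nonneg _) fun k _ => div_nonneg (wt_pos hlv k).le hQ.le,
          ← Finset.sum_div, ← homDim, div_self hQ.ne', Real.rpow_one]
    _ ≤ ∏ k, (C k * (1 + |x k|) ^ (-((homDim lv + d / 2) / wt lv k))) ^
          (wt lv k / homDim lv) := by
        gcongr with k
        · exact div_nonneg (wt_pos hlv k).le hQ.le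
        · exact hC k x
    _ = _ := by
        refine Finset.prod_congr rfl fun k _ => ?_
        have hw := (wt_pos hlv k).ne'
        rw [Real.mul_rpow (hC0 k) (by positivity), ← Real.rpow_mul (by positivity),
          Real.norm_eq_abs]
        congr 2
        field_simp

lemma integrable_heatKernel [NeZero n] (hlv : ∀ k, 0 < lv k) (hg : IsHom lv d g) (hd : 0 < d)
    {t : ℝ} (ht : 0 < t) : Integrable fun x => heatKernel lv g x t := by
  simp only [hg.heatKernel_eq_smul hlv _ ht]
  exact (integrable_comp_dil lv (inv_pos.2 ht) (hg.integrable_heatKernel_one hlv hd)).smul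
    (t ^ (-(d + homDim lv)))

lemma integral_norm_heatKernel (hlv : ∀ k, 0 < lv k) (hg : IsHom lv d g) {t : ℝ} (ht : 0 < t) :
    ∫ x, ‖heatKernel lv g x t‖ = t ^ (-d) * ∫ x, ‖heatKernel lv g x 1‖ := by
  simp only [hg.heatKernel_eq_smul hlv _ ht, norm_smul]
  rw [integral_const_mul, integral_comp_dil lv (inv_pos.2 ht) fun x => ‖heatKernel lv g x 1‖,
    Real.norm_of_nonneg (by positivity), Real.inv_rpow ht.le, inv_inv, smul_eq_mul, ← mul_assoc,
    ← Real.rpow_add ht, neg_add, neg_add_cancel_right]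

lemma exists_heatKernel_le (hlv : ∀ k, 0 < lv k) (hg : IsHom lv d g) :
    ∃ C ≥ 0, ∀ x, ∀ t > 0, ‖heatKernel lv g x t‖ ≤ C * t ^ (-(d + homDim lv)) := by
  refine ⟨∫ z, ‖Real.exp (-(1 * sigma lv z)) • g z‖, integral_nonneg fun _ => norm_nonneg _,
    fun x t ht => ?_⟩
  rw [hg.heatKernel_eq_smul hlv x ht, norm_smul, Real.norm_of_nonneg (by positivity), mul_comm]
  gcongr
  exact norm_invFourierInt_le _ _

lemma exists_heatKernel_le_coord [NeZero n] (hlv : ∀ k, 0 < lv k) (hg : IsHom lv d g)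
    (hd : -homDim lv < d) (k : Fin n) {a : ℝ} (ha : 0 ≤ a) (had : a < d + homDim lv) :
    ∃ C ≥ 0, ∀ x, x k ≠ 0 → ∀ t > 0, ‖heatKernel lv g x t‖ ≤
      C * |x k| ^ (-(a / wt lv k)) * t ^ (a - (d + homDim lv)) := by
  obtain ⟨C, hC0, hC⟩ := hg.exists_heatKernel_one_le hlv hd k ha had
  have hw := wt_pos hlv k
  refine ⟨C, hC0, fun x hx t ht => ?_⟩
  have hx' := abs_pos.2 hx
  calc ‖heatKernel lv g x t‖
      = t ^ (-(d + homDim lv)) * ‖heatKernel lv g (dil lv t⁻¹ x) 1‖ := by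
        rw [hg.heatKernel_eq_smul hlv x ht, norm_smul, Real.norm_of_nonneg (by positivity)]
    _ ≤ t ^ (-(d + homDim lv)) * (C * ((t ^ wt lv k)⁻¹ * |x k|) ^ (-(a / wt lv k))) := by
        gcongr
        refine (hC _).trans ?_
        rw [abs_dil_inv_apply lv ht]
        exact mul_le_mul_of_nonneg_left (Real.rpow_le_rpow_of_nonpos
          (mul_pos (inv_pos.2 (Real.rpow_pos_of_pos ht _)) hx')
          (le_add_of_nonneg_left zero_le_one) (neg_nonpos.2 (div_nonneg ha hw.le))) hC0
    _ = C * |x k| ^ (-(a / wt lv k)) * t ^ (a - (d + homDim lv)) := by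
        rw [Real.mul_rpow (by positivity) hx'.le, Real.inv_rpow (by positivity),
          ← Real.rpow_neg (Real.rpow_nonneg ht.le _), neg_neg, ← Real.rpow_mul ht.le,
          mul_div_cancel₀ _ hw.ne', sub_eq_neg_add, Real.rpow_add ht]
        ring

lemma integrableOn_heatKernel (hlv : ∀ k, 0 < lv k) (hg : IsHom lv d g) (hd : -homDim lv < d)
    (hd' : 1 < d + homDim lv) {x : EuclideanSpace ℝ (Fin n)} (hx : x ≠ 0) :
    IntegrableOn (heatKernel lv g x) (Ioi 0) := by
  obtain ⟨k, hk⟩ := exists_coord_ne_zero hx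
  have := k.neZero
  obtain ⟨A, -, hA⟩ := hg.exists_heatKernel_le_coord hlv hd k (a := d + homDim lv - 1 / 2)
    (by linarith) (by linarith)
  obtain ⟨B, -, hB⟩ := hg.exists_heatKernel_le hlv
  rw [sub_sub_cancel_left] at hA
  exact integrableOn_Ioi_of_rpow_bounds
    (hg.measurable_heatKernel measurable_const measurable_id).aestronglyMeasurable
    one_half_lt_one hd' (hA x hk) (hB x)

/-- Integrating in `y` first leaves `O(t⁻ᵈ)` as `t → 0` and `O(t^{-(d + Q)})` as `t → ∞`. -/
lemma integrable_prod_heatKernel_mul [NeZero n] (hlv : ∀ k, 0 < lv k) (hg : IsHom lv d g)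
    (hd : 0 < d) (hd' : d < 1) (hQ : 1 < d + homDim lv) {φ : EuclideanSpace ℝ (Fin n) → ℂ}
    (hφ : Integrable φ) {M : ℝ} (hM : ∀ y, ‖φ y‖ ≤ M) (x : EuclideanSpace ℝ (Fin n)) :
    Integrable (fun q : ℝ × EuclideanSpace ℝ (Fin n) => heatKernel lv g (x - q.2) q.1 * φ q.2)
      ((volume.restrict (Ioi 0)).prod volume) := by
  obtain ⟨C, -, hC⟩ := hg.exists_heatKernel_le hlv
  have hm : AEStronglyMeasurable (fun q : ℝ × EuclideanSpace ℝ (Fin n) =>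
      heatKernel lv g (x - q.2) q.1 * φ q.2) ((volume.restrict (Ioi 0)).prod volume) :=
    (hg.measurable_heatKernel (measurable_const.sub measurable_snd)
      measurable_fst).aestronglyMeasurable.mul hφ.1.comp_snd
  have hint (t : ℝ) (ht : 0 < t) : Integrable fun y => heatKernel lv g (x - y) t * φ y :=
    hφ.bdd_mul (hg.measurable_heatKernel (measurable_const.sub measurable_id)
      measurable_const).aestronglyMeasurable
      (ae_of_all _ fun y => hC (x - y) t ht)
  refine (integrable_prod_iff hm).2 ⟨(ae_restrict_mem measurableSet_Ioi).mono hint, ?_⟩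
  refine integrableOn_Ioi_of_rpow_bounds (A := M * ∫ y, ‖heatKernel lv g y 1‖)
    (B := C * ∫ y, ‖φ y‖) hm.norm.integral_prod_right' hd' hQ (fun t ht => ?_) (fun t ht => ?_)
  · rw [Real.norm_of_nonneg (integral_nonneg fun _ => norm_nonneg _), mul_assoc,
      mul_comm (∫ y, ‖heatKernel lv g y 1‖), ← hg.integral_norm_heatKernel hlv ht,
      ← integral_sub_left_eq_self (fun y => ‖heatKernel lv g y t‖) volume x,
      ← integral_const_mul]
    refine integral_mono (hint t ht).norm
      (((hg.integrable_heatKernel hlv hd ht).comp_sub_left x).norm.const_mul M) fun y => ?_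
    rw [norm_mul, mul_comm]
    exact mul_le_mul_of_nonneg_right (hM y) (norm_nonneg _)
  · rw [Real.norm_of_nonneg (integral_nonneg fun _ => norm_nonneg _), mul_right_comm,
      ← integral_const_mul]
    refine integral_mono (hint t ht).norm (hφ.norm.const_mul _) fun y => ?_
    rw [norm_mul]
    gcongr
    exact hC (x - y) t ht

end IsHom

/-- The kernel `∫₀^∞ J(x, t) dt` belonging to a scalar function `g` in place of `L⁻¹`. -/
def potential (lv : Fin n → ℕ) (g : EuclideanSpace ℝ (Fin n) → ℂ)
    (x : EuclideanSpace ℝ (Fin n)) : ℂ :=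
  ∫ t in Ioi (0 : ℝ), heatKernel lv (fun z => sigma lv z • g z) x t

namespace IsHom

variable {d : ℝ} {g : EuclideanSpace ℝ (Fin n) → ℂ}

lemma integrable_prod_heatKernel_sigma_smul_mul [NeZero n] (hlv : ∀ k, 0 < lv k)
    (hg : IsHom lv d g) (hd : -1 < d) (hd' : d < 0) (hQ : -homDim lv < d)
    (φ : 𝓢(EuclideanSpace ℝ (Fin n), ℂ)) (x : EuclideanSpace ℝ (Fin n)) :
    Integrable (fun q : ℝ × EuclideanSpace ℝ (Fin n) =>
      heatKernel lv (fun z => sigma lv z • g z) (x - q.2) q.1 * φ q.2)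
      ((volume.restrict (Ioi 0)).prod volume) :=
  ((isHom_sigma hlv).smul hg).integrable_prod_heatKernel_mul hlv (by linarith) (by linarith)
    (by linarith) φ.integrable (φ.toBoundedContinuousFunction.norm_coe_le_norm) x

lemma integrable_potential_mul [NeZero n] (hlv : ∀ k, 0 < lv k) (hg : IsHom lv d g)
    (hd : -1 < d) (hd' : d < 0) (hQ : -homDim lv < d) (φ : 𝓢(EuclideanSpace ℝ (Fin n), ℂ))
    (x : EuclideanSpace ℝ (Fin n)) : Integrable fun y => potential lv g (x - y) * φ y := by
  simp only [potential, ← integral_mul_const]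
  exact (hg.integrable_prod_heatKernel_sigma_smul_mul hlv hd hd' hQ φ x).integral_prod_right

lemma integral_potential_mul [NeZero n] (hlv : ∀ k, 0 < lv k) (hg : IsHom lv d g)
    (hd : -1 < d) (hd' : d < 0) (hQ : -homDim lv < d) (φ : 𝓢(EuclideanSpace ℝ (Fin n), ℂ))
    (x : EuclideanSpace ℝ (Fin n)) :
    ∫ y, potential lv g (x - y) * φ y = invFourierInt (fun z => g z * fourierInt φ z) x := by
  have hψ : Integrable fun z => g z * fourierInt φ z :=
    hg.integrable_mul hlv hQ hd'.le (fourierInt φ).integrable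
      (fourierInt φ).toBoundedContinuousFunction.norm_coe_le_norm
  calc ∫ y, potential lv g (x - y) * φ y
      = ∫ y, ∫ t in Ioi (0 : ℝ), heatKernel lv (fun z => sigma lv z • g z) (x - y) t * φ y := by
        simp only [potential, integral_mul_const]
    _ = ∫ t in Ioi (0 : ℝ), ∫ y, heatKernel lv (fun z => sigma lv z • g z) (x - y) t * φ y :=
        (integral_integral_swap
          (hg.integrable_prod_heatKernel_sigma_smul_mul hlv hd hd' hQ φ x)).symm
    _ = ∫ t in Ioi (0 : ℝ), ∫ z, (t ^ 0 * sigma lv z ^ (0 + 1) * Real.exp (-(t * sigma lv z))) •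
          (planeWave x z • (g z * fourierInt φ z)) := by
        refine setIntegral_congr_fun measurableSet_Ioi fun t ht => ?_
        have hint := ((isHom_sigma hlv).smul hg).integrable_exp_neg_smul hlv (by linarith) ht
        simp only [heatKernel, integral_invFourierInt_sub_mul hint φ.integrable, ← fourierInt_apply]
        refine integral_congr_ae (ae_of_all _ fun z => ?_)
        simp only [Complex.real_smul, smul_eq_mul]
        push_cast
        ring
    _ = _ := by
        rw [integral_subordination (measurable_sigma lv) ae_sigma_pos
          (integrable_planeWave_smul hψ x) 0, Nat.factorial_zero, Nat.cast_one, one_mul,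
          invFourierInt]

end IsHom

end TimeIntegral

section SymbolInverse

variable {n m l : ℕ} {lv : Fin n → ℕ} {A : (Fin n → ℕ) →₀ Matrix (Fin m) (Fin m) ℂ}

lemma gam_eq (l : ℕ) (lv : Fin n → ℕ) (k : Fin n) : (gam l lv k : ℝ) = 2 * l * wt lv k := by
  rw [gam, wt]
  push_cast
  ring

lemma neZero_of_homDim_pos (h : 0 < homDim lv) : NeZero n :=
  ⟨by rintro rfl; simp [homDim] at h⟩

namespace IsSemielliptic

lemma sum_mul_wt (hA : IsSemielliptic l lv A) {α : Fin n → ℕ} (hα : A α ≠ 0) :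
    ∑ k, wt lv k * α k = 1 / 2 := by
  have hl : (l : ℝ) ≠ 0 := Nat.cast_ne_zero.2 hA.order_pos.ne'
  have h : ∑ k, α k * (gam l lv k : ℝ) = l := by exact_mod_cast hA.weight α hα
  simp only [gam_eq, mul_left_comm _ (2 * (l : ℝ)), ← Finset.mul_sum, mul_comm (α _ : ℝ)] at h
  exact mul_left_cancel₀ hl (by linarith)

lemma half_lt_homDim (hA : IsSemielliptic l lv A) (hγ : (l : ℚ) < gamNorm l lv) :
    1 / 2 < homDim lv := by
  have hl : (0 : ℝ) < l := Nat.cast_pos.2 hA.order_pos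
  have h : (l : ℝ) < ∑ k, (gam l lv k : ℝ) := by exact_mod_cast hγ
  simp only [gam_eq, ← Finset.mul_sum] at h
  rw [homDim]
  exact lt_of_mul_lt_mul_left (by linarith) hl.le

lemma symbol_dil (hA : IsSemielliptic l lv A) {s : ℝ} (hs : 0 < s)
    (z : EuclideanSpace ℝ (Fin n)) :
    symbol A (dil lv s z) = ((s ^ (1 / 2 : ℝ) : ℝ) : ℂ) • symbol A z := by
  simp only [symbol, Finsupp.sum, Finset.smul_sum]
  refine Finset.sum_congr rfl fun α hα => ?_
  rw [smul_smul, ← hA.sum_mul_wt (Finsupp.mem_support_iff.1 hα), Real.rpow_sum_of_pos hs,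
    Complex.ofReal_prod, ← Finset.prod_mul_distrib]
  congr 1
  refine Finset.prod_congr rfl fun k _ => ?_
  rw [dil_apply, Real.rpow_mul_natCast hs.le]
  push_cast
  ring

lemma isUnit_det_symbol (hA : IsSemielliptic l lv A) {z : EuclideanSpace ℝ (Fin n)}
    (hz : z ≠ 0) : IsUnit (symbol A z).det :=
  (Matrix.isUnit_iff_isUnit_det _).1 (hA.symbol_isUnit z hz)

end IsSemielliptic

lemma matrix_inv_smul {ι K : Type*} [Fintype ι] [DecidableEq ι] [Field K] {c : K} (hc : c ≠ 0)
    (M : Matrix ι ι K) : (c • M)⁻¹ = c⁻¹ • M⁻¹ := by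
  by_cases hM : IsUnit M.det
  · exact Matrix.inv_smul' M (Units.mk0 c hc) hM
  · rw [Matrix.nonsing_inv_apply_not_isUnit _ hM, smul_zero,
      Matrix.nonsing_inv_apply_not_isUnit]
    rw [Matrix.det_smul]
    exact fun h => hM (isUnit_of_mul_isUnit_right h)

section ContDiffMatrix

variable {E ι : Type*} [NormedAddCommGroup E] [NormedSpace ℝ E] [Fintype ι] [DecidableEq ι]
  {M : E → Matrix ι ι ℂ} {r : WithTop ℕ∞}

lemma contDiff_det (hM : ∀ i j, ContDiff ℝ r fun z => M z i j) :
    ContDiff ℝ r fun z => (M z).det := by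
  simp only [Matrix.det_apply']
  exact ContDiff.sum fun σ _ => contDiff_const.mul (contDiff_prod fun i _ => hM _ _)

lemma contDiff_adjugate (hM : ∀ i j, ContDiff ℝ r fun z => M z i j) (i j : ι) :
    ContDiff ℝ r fun z => (M z).adjugate i j := by
  simp only [Matrix.adjugate_apply]
  refine contDiff_det fun a b => ?_
  simp only [Matrix.updateRow_apply]
  split_ifs
  · exact contDiff_const
  · exact hM a b

lemma contDiffOn_matrix_inv (hM : ∀ i j, ContDiff ℝ r fun z => M z i j) {s : Set E}
    (hs : ∀ z ∈ s, IsUnit (M z).det) (i j : ι) : ContDiffOn ℝ r (fun z => (M z)⁻¹ i j) s := by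
  simp only [Matrix.inv_def, Ring.inverse_eq_inv', Matrix.smul_apply, smul_eq_mul]
  exact ((contDiff_det hM).contDiffOn.inv fun z hz => (hs z hz).ne_zero).mul
    (contDiff_adjugate hM i j).contDiffOn

end ContDiffMatrix

lemma contDiff_symbol (A : (Fin n → ℕ) →₀ Matrix (Fin m) (Fin m) ℂ) (i j : Fin m) :
    ContDiff ℝ ∞ fun z => symbol A z i j := by
  simp only [symbol, Finsupp.sum, Matrix.sum_apply, Matrix.smul_apply, smul_eq_mul]
  refine ContDiff.sum fun α _ => ContDiff.mul (contDiff_prod fun k _ => ContDiff.pow ?_ _)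
    contDiff_const
  exact contDiff_const.mul (Complex.ofRealCLM.contDiff.comp
    (EuclideanSpace.proj (𝕜 := ℝ) k).contDiff)

lemma IsSemielliptic.isHom_symbol_inv (hA : IsSemielliptic l lv A) (i j : Fin m) :
    IsHom lv (-(1 / 2)) fun z => (symbol A z)⁻¹ i j where
  contDiffOn := contDiffOn_matrix_inv (contDiff_symbol A) (fun _ hz => hA.isUnit_det_symbol hz) i j
  map_dil s hs z := by
    have hc : ((s ^ (1 / 2 : ℝ) : ℝ) : ℂ) ≠ 0 :=
      Complex.ofReal_ne_zero.2 (Real.rpow_pos_of_pos hs _).ne'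
    rw [hA.symbol_dil hs, matrix_inv_smul hc, Matrix.smul_apply, ← Complex.ofReal_inv,
      Complex.coe_smul, ← Real.rpow_neg hs.le]

end SymbolInverse

section FourierMultiplier

variable {n m : ℕ}

lemma inner_single_one (z : EuclideanSpace ℝ (Fin n)) (k : Fin n) :
    ⟪z, EuclideanSpace.single k (1 : ℝ)⟫ = z k := by
  rw [EuclideanSpace.inner_single_right, one_mul, conj_trivial]

namespace HasMoments

variable {G : EuclideanSpace ℝ (Fin n) → Fin m → ℂ}

lemma coord_pow_smul (hG : HasMoments G) (k : Fin n) (a : ℕ) :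
    HasMoments fun z => (Complex.I * z k) ^ a • G z := by
  induction a with
  | zero => simpa only [pow_zero, one_smul] using hG
  | succ a ih =>
    simpa only [inner_single_one, smul_smul, ← pow_succ'] using
      ih.inner_smul (EuclideanSpace.single k (1 : ℝ))

lemma iterate_pderiv_invFourierInt (hG : HasMoments G) (k : Fin n) (a : ℕ) :
    (pderiv k)^[a] (invFourierInt G) = invFourierInt fun z => (Complex.I * z k) ^ a • G z := by
  induction a with
  | zero => simp only [Function.iterate_zero, id_eq, pow_zero, one_smul]
  | succ a ih =>
    ext1 x
    rw [Function.iterate_succ_apply', ih, pderiv,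
      (hG.coord_pow_smul k a).lineDeriv_invFourierInt]
    simp only [inner_single_one, smul_smul, ← pow_succ']

lemma prod_coord_pow_smul (hG : HasMoments G) (α : Fin n → ℕ) (L : List (Fin n)) :
    HasMoments fun z => (L.map fun k => (Complex.I * (z k : ℂ)) ^ α k).prod • G z := by
  induction L with
  | nil => simpa only [List.map_nil, List.prod_nil, one_smul] using hG
  | cons k L ih =>
    simpa only [List.map_cons, List.prod_cons, mul_smul] using ih.coord_pow_smul k (α k)

lemma foldr_pderiv_invFourierInt (hG : HasMoments G) (α : Fin n → ℕ) (L : List (Fin n)) :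
    L.foldr (fun k v => (pderiv k)^[α k] v) (invFourierInt G) =
      invFourierInt fun z => (L.map fun k => (Complex.I * (z k : ℂ)) ^ α k).prod • G z := by
  induction L with
  | nil => simp only [List.foldr_nil, List.map_nil, List.prod_nil, one_smul]
  | cons k L ih =>
    rw [List.foldr_cons, ih, (hG.prod_coord_pow_smul α L).iterate_pderiv_invFourierInt]
    simp only [List.map_cons, List.prod_cons, mul_smul]

lemma monomial_smul (hG : HasMoments G) (α : Fin n → ℕ) :
    HasMoments fun z => (∏ k, (Complex.I * (z k : ℂ)) ^ α k) • G z := by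
  simpa only [Fin.prod_univ_def] using hG.prod_coord_pow_smul α (List.finRange n)

lemma multiDeriv_invFourierInt (hG : HasMoments G) (α : Fin n → ℕ) :
    multiDeriv α (invFourierInt G) =
      invFourierInt fun z => (∏ k, (Complex.I * (z k : ℂ)) ^ α k) • G z := by
  simpa only [multiDeriv, Fin.prod_univ_def] using hG.foldr_pderiv_invFourierInt α (List.finRange n)

lemma diffOp_invFourierInt (hG : HasMoments G) (A : (Fin n → ℕ) →₀ Matrix (Fin m) (Fin m) ℂ) :
    diffOp A (invFourierInt G) = invFourierInt fun z => (symbol A z).mulVec (G z) := by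
  ext1 x
  let T (α : Fin n → ℕ) : (Fin m → ℂ) →L[ℂ] (Fin m → ℂ) := (A α).mulVecLin.toContinuousLinearMap
  let H (α : Fin n → ℕ) (z : EuclideanSpace ℝ (Fin n)) : Fin m → ℂ :=
    planeWave x z • (∏ k, (Complex.I * (z k : ℂ)) ^ α k) • G z
  have hH (α : Fin n → ℕ) : Integrable (H α) :=
    integrable_planeWave_smul (hG.monomial_smul α).integrable x
  calc diffOp A (invFourierInt G) x = ∑ α ∈ A.support, T α (∫ z, H α z) :=
        Finset.sum_congr rfl fun α _ => by simp only [hG.multiDeriv_invFourierInt]; rfl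
    _ = ∫ z, ∑ α ∈ A.support, T α (H α z) := by
        rw [integral_finsetSum _ fun α _ => (T α).integrable_comp (hH α)]
        exact Finset.sum_congr rfl fun α _ => ((T α).integral_comp_comm (hH α)).symm
    _ = invFourierInt (fun z => (symbol A z).mulVec (G z)) x := by
        refine integral_congr_ae (ae_of_all _ fun z => ?_)
        simp only [symbol, Finsupp.sum, Matrix.sum_mulVec, Finset.smul_sum, Matrix.smul_mulVec]
        exact Finset.sum_congr rfl fun α _ => by simp only [H, map_smul]; rfl

lemma of_apply (hG : ∀ i, HasMoments fun z => G z i) : HasMoments G :=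
  fun p => Integrable.of_eval fun i => hG i p

end HasMoments

end FourierMultiplier

section FundamentalSolution

variable {n m l : ℕ} {lv : Fin n → ℕ} {A : (Fin n → ℕ) →₀ Matrix (Fin m) (Fin m) ℂ}

lemma planeWave_eq (x z : EuclideanSpace ℝ (Fin n)) :
    planeWave x z = Complex.exp (Complex.I * ((∑ k, x k * z k : ℝ) : ℂ)) := by
  simp only [planeWave, PiLp.inner_apply, RCLike.inner_apply, conj_trivial, mul_comm]

lemma kernelIntegrand_apply (lv : Fin n → ℕ) (A : (Fin n → ℕ) →₀ Matrix (Fin m) (Fin m) ℂ)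
    (x : EuclideanSpace ℝ (Fin n)) (t : ℝ) (z : EuclideanSpace ℝ (Fin n)) (i j : Fin m) :
    kernelIntegrand lv A x t z i j =
      planeWave x z • Real.exp (-(t * sigma lv z)) • sigma lv z • (symbol A z)⁻¹ i j := by
  simp only [kernelIntegrand, Matrix.smul_apply, smul_eq_mul, planeWave_eq, Complex.real_smul]
  push_cast
  ring

lemma kernelJ_apply (lv : Fin n → ℕ) (A : (Fin n → ℕ) →₀ Matrix (Fin m) (Fin m) ℂ)
    (x : EuclideanSpace ℝ (Fin n)) (t : ℝ) (i j : Fin m) :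
    kernelJ lv A x t i j = heatKernel lv (fun z => sigma lv z • (symbol A z)⁻¹ i j) x t := by
  simp only [kernelJ, Matrix.of_apply, kernelIntegrand_apply, heatKernel, invFourierInt]

lemma fundSol_apply (lv : Fin n → ℕ) (A : (Fin n → ℕ) →₀ Matrix (Fin m) (Fin m) ℂ)
    (x : EuclideanSpace ℝ (Fin n)) (i j : Fin m) :
    fundSol lv A x i j =
      (((2 * Real.pi) ^ n : ℝ) : ℂ)⁻¹ * potential lv (fun z => (symbol A z)⁻¹ i j) x := by
  simp only [fundSol, Matrix.of_apply, kernelJ_apply, potential]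

lemma IsHom.hasMoments_mul {d : ℝ} {g : EuclideanSpace ℝ (Fin n) → ℂ} (hlv : ∀ k, 0 < lv k)
    (hg : IsHom lv d g) (hd : -homDim lv < d) (hd' : d ≤ 0) (φ : 𝓢(EuclideanSpace ℝ (Fin n), ℂ)) :
    HasMoments fun z => g z * φ z := fun p => by
  have hφ : Integrable fun z => ‖z‖ ^ p • φ z :=
    (φ.integrable_pow_mul volume p).mono'
      ((continuous_norm.pow p).smul φ.continuous).aestronglyMeasurable
      (ae_of_all _ fun z => by rw [norm_smul, norm_pow, norm_norm])
  simpa only [mul_smul_comm] using hg.integrable_mul hlv hd hd' hφ fun z => by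
    rw [norm_smul, norm_pow, norm_norm]
    exact φ.norm_pow_mul_le_seminorm ℝ p z

/-- The `j`-th component of a vector-valued Schwartz function. -/
def component (f : 𝓢(EuclideanSpace ℝ (Fin n), Fin m → ℂ)) (j : Fin m) :
    𝓢(EuclideanSpace ℝ (Fin n), ℂ) :=
  SchwartzMap.postcompCLM (ContinuousLinearMap.proj (R := ℂ) j) f

lemma fourierInt_component (f : 𝓢(EuclideanSpace ℝ (Fin n), Fin m → ℂ)) (j : Fin m)
    (z : EuclideanSpace ℝ (Fin n)) : fourierInt (component f j) z = fourierInt f z j := by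
  rw [fourierInt_apply, fourierInt_apply, invFourierInt_apply f.integrable]
  rfl

/-- The Fourier transform of the solution of `ℒu = f`, with the factor `(2π)⁻ⁿ` of the inversion
formula included. -/
def solTransform (A : (Fin n → ℕ) →₀ Matrix (Fin m) (Fin m) ℂ)
    (f : 𝓢(EuclideanSpace ℝ (Fin n), Fin m → ℂ)) (z : EuclideanSpace ℝ (Fin n)) : Fin m → ℂ :=
  (((2 * Real.pi) ^ n : ℝ) : ℂ)⁻¹ • (symbol A z)⁻¹.mulVec (fourierInt f z)

lemma solTransform_apply (A : (Fin n → ℕ) →₀ Matrix (Fin m) (Fin m) ℂ)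
    (f : 𝓢(EuclideanSpace ℝ (Fin n), Fin m → ℂ)) (z : EuclideanSpace ℝ (Fin n)) (i : Fin m) :
    solTransform A f z i = (((2 * Real.pi) ^ n : ℝ) : ℂ)⁻¹ *
      ∑ j, (symbol A z)⁻¹ i j * fourierInt (component f j) z := by
  simp only [solTransform, Pi.smul_apply, smul_eq_mul, Matrix.mulVec, dotProduct,
    fourierInt_component]

namespace IsSemielliptic

variable (f : 𝓢(EuclideanSpace ℝ (Fin n), Fin m → ℂ))

lemma integrable_kernelIntegrand (hA : IsSemielliptic l lv A) (x : EuclideanSpace ℝ (Fin n))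
    {t : ℝ} (ht : 0 < t) (i j : Fin m) : Integrable fun z => kernelIntegrand lv A x t z i j := by
  have hQ := homDim_nonneg hA.lv_pos
  simp only [kernelIntegrand_apply]
  exact integrable_planeWave_smul (((isHom_sigma hA.lv_pos).smul
    (hA.isHom_symbol_inv i j)).integrable_exp_neg_smul hA.lv_pos (by linarith) ht) x

lemma integrableOn_kernelJ (hA : IsSemielliptic l lv A) (hγ : (l : ℚ) < gamNorm l lv)
    {x : EuclideanSpace ℝ (Fin n)} (hx : x ≠ 0) (i j : Fin m) :
    IntegrableOn (fun t => kernelJ lv A x t i j) (Ioi 0) := by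
  have hQ := hA.half_lt_homDim hγ
  simp only [kernelJ_apply]
  exact ((isHom_sigma hA.lv_pos).smul (hA.isHom_symbol_inv i j)).integrableOn_heatKernel
    hA.lv_pos (by linarith) (by linarith) hx

lemma integrable_fundSol_mul (hA : IsSemielliptic l lv A) (hγ : (l : ℚ) < gamNorm l lv)
    (x : EuclideanSpace ℝ (Fin n)) (i j : Fin m) :
    Integrable fun y => fundSol lv A (x - y) i j * f y j := by
  have hQ := hA.half_lt_homDim hγ
  have := neZero_of_homDim_pos (lv := lv) (by linarith)
  simp only [fundSol_apply, mul_assoc]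
  exact ((hA.isHom_symbol_inv i j).integrable_potential_mul hA.lv_pos (by norm_num) (by norm_num)
    (by linarith) (component f j) x).const_mul _

lemma integral_fundSol_mul (hA : IsSemielliptic l lv A) (hγ : (l : ℚ) < gamNorm l lv)
    (x : EuclideanSpace ℝ (Fin n)) (i j : Fin m) :
    ∫ y, fundSol lv A (x - y) i j * f y j = (((2 * Real.pi) ^ n : ℝ) : ℂ)⁻¹ *
      invFourierInt (fun z => (symbol A z)⁻¹ i j * fourierInt (component f j) z) x := by
  have hQ := hA.half_lt_homDim hγ
  have := neZero_of_homDim_pos (lv := lv) (by linarith)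
  simp only [fundSol_apply, mul_assoc, integral_const_mul]
  congr 1
  exact (hA.isHom_symbol_inv i j).integral_potential_mul hA.lv_pos (by norm_num) (by norm_num)
    (by linarith) (component f j) x

lemma integrable_fundSol_mulVec (hA : IsSemielliptic l lv A) (hγ : (l : ℚ) < gamNorm l lv)
    (x : EuclideanSpace ℝ (Fin n)) : Integrable fun y => (fundSol lv A (x - y)).mulVec (f y) :=
  Integrable.of_eval fun i => integrable_finsetSum Finset.univ fun j _ =>
    hA.integrable_fundSol_mul f hγ x i j

lemma hasMoments_symbol_inv_mul (hA : IsSemielliptic l lv A) (hγ : (l : ℚ) < gamNorm l lv)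
    (i j : Fin m) :
    HasMoments fun z => (symbol A z)⁻¹ i j * fourierInt (component f j) z :=
  (hA.isHom_symbol_inv i j).hasMoments_mul hA.lv_pos (by linarith [hA.half_lt_homDim hγ])
    (by norm_num) _

lemma hasMoments_solTransform (hA : IsSemielliptic l lv A) (hγ : (l : ℚ) < gamNorm l lv) :
    HasMoments (solTransform A f) :=
  HasMoments.of_apply fun i p => by
    refine ((integrable_finsetSum Finset.univ fun j _ =>
      hA.hasMoments_symbol_inv_mul f hγ i j p).const_mul
        (((2 * Real.pi) ^ n : ℝ) : ℂ)⁻¹).congr (ae_of_all _ fun z => ?_)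
    dsimp only
    rw [solTransform_apply, ← Finset.smul_sum, mul_smul_comm]

lemma opS_eq_invFourierInt (hA : IsSemielliptic l lv A) (hγ : (l : ℚ) < gamNorm l lv) :
    opS lv A f = invFourierInt (solTransform A f) := by
  ext x i
  calc opS lv A f x i = ∫ y, ∑ j, fundSol lv A (x - y) i j * f y j :=
        eval_integral (fun i => (hA.integrable_fundSol_mulVec f hγ x).eval i) i
    _ = ∑ j, (((2 * Real.pi) ^ n : ℝ) : ℂ)⁻¹ *
          invFourierInt (fun z => (symbol A z)⁻¹ i j * fourierInt (component f j) z) x := by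
        rw [integral_finsetSum _ fun j _ => hA.integrable_fundSol_mul f hγ x i j]
        simp only [hA.integral_fundSol_mul f hγ x i]
    _ = invFourierInt (fun z => solTransform A f z i) x := by
        simp only [invFourierInt]
        rw [← Finset.mul_sum, ← integral_finsetSum _ fun j _ => integrable_planeWave_smul
          (hA.hasMoments_symbol_inv_mul f hγ i j).integrable x, ← integral_const_mul]
        refine integral_congr_ae (ae_of_all _ fun z => ?_)
        dsimp only
        rw [solTransform_apply, ← Finset.smul_sum, mul_smul_comm]
    _ = _ := (invFourierInt_apply (hA.hasMoments_solTransform f hγ).integrable x i).symm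

lemma symbol_mulVec_solTransform (hA : IsSemielliptic l lv A) {z : EuclideanSpace ℝ (Fin n)}
    (hz : z ≠ 0) : (symbol A z).mulVec (solTransform A f z) =
      (((2 * Real.pi) ^ n : ℝ) : ℂ)⁻¹ • fourierInt f z := by
  rw [solTransform, Matrix.mulVec_smul, Matrix.mulVec_mulVec,
    Matrix.mul_nonsing_inv _ (hA.isUnit_det_symbol hz), Matrix.one_mulVec]

lemma contDiff_opS (hA : IsSemielliptic l lv A) (hγ : (l : ℚ) < gamNorm l lv) :
    ContDiff ℝ ∞ (opS lv A f) := by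
  rw [hA.opS_eq_invFourierInt f hγ]
  exact (hA.hasMoments_solTransform f hγ).contDiff_invFourierInt

lemma diffOp_opS (hA : IsSemielliptic l lv A) (hγ : (l : ℚ) < gamNorm l lv) :
    diffOp A (opS lv A f) = f := by
  have := neZero_of_homDim_pos (lv := lv) (by linarith [hA.half_lt_homDim hγ])
  have hpi : (2 * Real.pi) ^ n ≠ 0 := pow_ne_zero n Real.two_pi_pos.ne'
  rw [hA.opS_eq_invFourierInt f hγ, (hA.hasMoments_solTransform f hγ).diffOp_invFourierInt]
  ext1 x
  calc invFourierInt (fun z => (symbol A z).mulVec (solTransform A f z)) x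
      = ∫ z, (((2 * Real.pi) ^ n : ℝ) : ℂ)⁻¹ • planeWave x z • fourierInt f z := by
        refine integral_congr_ae ((Measure.ae_ne volume 0).mono fun z hz => ?_)
        dsimp only
        rw [hA.symbol_mulVec_solTransform f hz, smul_comm]
    _ = (((2 * Real.pi) ^ n : ℝ) : ℂ)⁻¹ • invFourierInt (fourierInt f) x := integral_smul _ _
    _ = f x := by
        rw [invFourierInt_fourierInt, finrank_euclideanSpace_fin, ← Complex.ofReal_inv,
          Complex.coe_smul, inv_smul_smul₀ hpi]

end IsSemielliptic

end FundamentalSolution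

end Semielliptic

end

theorem theorem3p2_general {n m : ℕ} (l : ℕ) (lv : Fin n → ℕ)
    (A : (Fin n → ℕ) →₀ Matrix (Fin m) (Fin m) ℂ)
    (hA : Semielliptic.IsSemielliptic l lv A)
    (hγ : (l : ℚ) < Semielliptic.gamNorm l lv) :
    (∀ (x : EuclideanSpace ℝ (Fin n)) (t : ℝ), 0 < t → ∀ i j,
      MeasureTheory.Integrable (fun z => Semielliptic.kernelIntegrand lv A x t z i j)) ∧
    (∀ x : EuclideanSpace ℝ (Fin n), x ≠ 0 → ∀ i j,
      MeasureTheory.IntegrableOn (fun t => Semielliptic.kernelJ lv A x t i j) (Set.Ioi 0)) ∧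
    (∀ f : SchwartzMap (EuclideanSpace ℝ (Fin n)) (Fin m → ℂ),
      (∀ x, MeasureTheory.Integrable
        (fun y => (Semielliptic.fundSol lv A (x - y)).mulVec (f y))) ∧
      ContDiff ℝ ∞ (Semielliptic.opS lv A f) ∧
      Semielliptic.diffOp A (Semielliptic.opS lv A f) = f) :=
  ⟨fun x _ ht i j => hA.integrable_kernelIntegrand x ht i j,
    fun _ hx i j => hA.integrableOn_kernelJ hγ hx i j,
    fun f => ⟨hA.integrable_fundSol_mulVec f hγ, hA.contDiff_opS f hγ, hA.diffOp_opS f hγ⟩⟩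

theorem theorem3p2 {n m : ℕ} (l : ℕ) (lv : Fin n → ℕ)
    (A : (Fin n → ℕ) →₀ Matrix (Fin m) (Fin m) ℂ)
    (hA : Semielliptic.IsSemielliptic l lv A)
    (hγ : (l : ℚ) < Semielliptic.gamNorm l lv) :
    -- the integrals that define `F` converge absolutely
    (∀ (x : EuclideanSpace ℝ (Fin n)) (t : ℝ), 0 < t → ∀ i j,
      MeasureTheory.Integrable (fun z => Semielliptic.kernelIntegrand lv A x t z i j)) ∧
    (∀ x : EuclideanSpace ℝ (Fin n), x ≠ 0 → ∀ i j,
      MeasureTheory.IntegrableOn (fun t => Semielliptic.kernelJ lv A x t i j) (Set.Ioi 0)) ∧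
    -- the convolution with a test function solves the equation
    (∀ f : EuclideanSpace ℝ (Fin n) → Fin m → ℂ, ContDiff ℝ ∞ f → HasCompactSupport f →
      (∀ x, MeasureTheory.Integrable
        (fun y => (Semielliptic.fundSol lv A (x - y)).mulVec (f y))) ∧
      ContDiff ℝ ∞ (Semielliptic.opS lv A f) ∧
      Semielliptic.diffOp A (Semielliptic.opS lv A f) = f) :=
  (theorem3p2_general l lv A hA hγ).imp_right fun h =>
    h.imp_right fun h _ hf hfc => h (hfc.toSchwartzMap hf)
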